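/- For each $n\in\mathbb N$ let $X_1,\dots,X_n$ be i.i.d. $\mathcal N(0,1)$ random variables with order statistics $X_{(1)}\le X_{(2)}\le\dots\le X_{(n)}$. Then the normalized largest spacing $\sqrt{2\log n}\,\max_{2\le j\le n}\big(X_{(j)}-X_{(j-1)}\big)$ converges in distribution to the probability distribution on $\mathbb R$ with cumulative distribution function $$F(x)=\prod_{j=1}^{\infty}\big(1-e^{-jx}\big)^2\quad (x\ge 0),\qquad F(x)=0\quad (x<0),$$ where the infinite product converges for every $x\ge 0$. More precisely, for every $x\in\mathbb R$, $$\lim_{n\to\infty}\mathbb P\Big(\sqrt{2\log n}\,\max_{2\le j\le n}\big(X_{(j)}-X_{(j-1)}\big)\le x\Big)=F(x).$$ -/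

import Mathlib

open MeasureTheory ProbabilityTheory Filter Topology

noncomputable section

/-- The order statistics of a sample `v` of size `n`: the sample rearranged in nondecreasing
order. With 0-based indices, `orderStat v i` is the `(i+1)`-st smallest value. -/
def orderStat {n : ℕ} (v : Fin n → ℝ) : Fin n → ℝ := v ∘ Tuple.sort v

/-- The largest spacing between consecutive order statistics. For `n ≥ 2` this is a maximum over
a nonempty finite index set (the value for `n < 2` is the conventional `0`). -/
def maxSpacing {n : ℕ} (v : Fin n → ℝ) : ℝ :=
  ⨆ i : Fin (n - 1),
    (orderStat v ⟨(i : ℕ) + 1, by omega⟩ - orderStat v ⟨(i : ℕ), by omega⟩)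

/-- The function `x ↦ ∏_{j ≥ 1} (1 - exp (-j x))²` for `x ≥ 0`, extended by `0` to `x < 0`. -/
def deheuvelsCDF (x : ℝ) : ℝ :=
  if x < 0 then 0 else ∏' j : ℕ, (1 - Real.exp (-((j : ℝ) + 1) * x)) ^ 2

end

/-!
Write `Φ̄` for the standard normal tail, `a = √(2 log n)` and `δ = x / a` with `x > 0`. The event in
question says that the sample, as a set of points, has no gap longer than `δ` (`GapFree`,
`maxSpacing_le_iff`).

The heart of the matter is a chain of conditional laws in the upper tail. Given that `j` points lie
above `s`, the lowest of them exceeds `s + δ` with probability `(Φ̄(s + δ) / Φ̄(s)) ^ j`, and given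
its position the other `j - 1` points are again a sample above that position. For `s` close to `a`
the ratio `Φ̄(s + δ) / Φ̄(s)` is close to `exp (-aδ) = exp (-x)`, so that a sample of size `m`
conditioned to lie above `(1 - ε) a` is free of gaps with probability close to
`∏_{j ≤ m} (1 - exp (-j x))`. The lemmas `le_upChain` and `upChainUpTo_le` make this precise by
induction on `m`: only the two bounds `Φ̄(s + δ) ≤ ρ Φ̄(s)` and `ρ Φ̄(s) ≤ Φ̄(s + δ)` enter, and no
joint law of order statistics is needed.

The points above `(1 - ε) a` and those below `-(1 - ε) a` are conditionally independent given which
indices they have (`stdGaussianPi_real_fiber`), which produces the square. Between the two tails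
there is no long gap: up to `(1 - ε') a` every interval of length `δ` has mass of larger order than
`1 / n`, and a union bound over cells of length `δ / 2` applies (`tendsto_not_full`). That interval
condition also links the two tails to the bulk and guarantees many points in each tail. Together
this gives `sq_le_gapFree` and `gapFree_le`; letting `n → ∞` and then `ε → 0` yields
`tendsto_gapFree`.

The case `x = 0` follows from `x > 0` by monotonicity and right continuity of the limit, which is
also what makes the limit a distribution function.
-/

/-! ### Gaps of finite point sets and order statistics -/

/-- The set `Z` has no gap longer than `δ`: strictly between any two points of `Z` at distance
more than `δ` there is a third one. For a finite set this says that consecutive points are at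
distance at most `δ`. -/
def GapFree (δ : ℝ) (Z : Set ℝ) : Prop :=
  ∀ a ∈ Z, ∀ b ∈ Z, a + δ < b → ∃ c ∈ Z, a < c ∧ c < b

lemma GapFree.neg {δ : ℝ} {Z : Set ℝ} (h : GapFree δ Z) : GapFree δ (-Z) := by
  intro a ha b hb hab
  obtain ⟨c, hc, h1, h2⟩ := h (-b) hb (-a) ha (by linarith)
  exact ⟨-c, by simpa using hc, by linarith, by linarith⟩

lemma measurableSet_gapFree_range {α κ : Type*} [MeasurableSpace α] [Countable κ] (δ : ℝ)
    {f : α → κ → ℝ} (hf : ∀ i, Measurable fun a => f a i) :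
    MeasurableSet {a | GapFree δ (Set.range (f a))} := by
  simp only [GapFree, Set.forall_mem_range, Set.exists_range_iff]
  refine measurableSet_setOfPred.2 (Measurable.forall fun i => Measurable.forall fun j =>
    Measurable.imp ?_ (Measurable.exists fun k => Measurable.and ?_ ?_))
  · exact measurableSet_setOfPred.1 (measurableSet_lt ((hf i).add_const δ) (hf j))
  · exact measurableSet_setOfPred.1 (measurableSet_lt (hf i) (hf k))
  · exact measurableSet_setOfPred.1 (measurableSet_lt (hf k) (hf j))

lemma measurableSet_gapFree_insert {α κ : Type*} [MeasurableSpace α] [Countable κ] (δ : ℝ)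
    {g : α → ℝ} (hg : Measurable g) {f : α → κ → ℝ} (hf : ∀ i, Measurable fun a => f a i) :
    MeasurableSet {a | GapFree δ (insert (g a) (Set.range (f a)))} := by
  have h : ∀ a, insert (g a) (Set.range (f a)) =
      Set.range (fun o : Option κ => o.elim (g a) (f a)) := by
    intro a
    ext z
    simp [Option.exists, eq_comm]
  simp only [h]
  refine measurableSet_gapFree_range δ fun o => ?_
  cases o with
  | none => exact hg
  | some i => exact hf i

lemma monotone_orderStat {n : ℕ} (v : Fin n → ℝ) : Monotone (orderStat v) :=
  Tuple.monotone_sort v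

lemma range_orderStat {n : ℕ} (v : Fin n → ℝ) : Set.range (orderStat v) = Set.range v :=
  (Tuple.sort v).surjective.range_comp v

lemma maxSpacing_nonneg {n : ℕ} (v : Fin n → ℝ) : 0 ≤ maxSpacing v :=
  Real.iSup_nonneg fun _ => sub_nonneg.2 (monotone_orderStat v (Fin.mk_le_mk.2 (Nat.le_succ _)))

/-- The largest spacing is at most `δ` exactly when the sample, as a set of points, has no gap
longer than `δ`. -/
lemma maxSpacing_le_iff {n : ℕ} (v : Fin n → ℝ) {δ : ℝ} (hδ : 0 ≤ δ) :
    maxSpacing v ≤ δ ↔ GapFree δ (Set.range v) := by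
  rw [← range_orderStat v]
  have hmono := monotone_orderStat v
  constructor
  · intro h
    rintro _ ⟨i, rfl⟩ _ ⟨j, rfl⟩ hij
    have hstep : ∀ l (hl : l + 1 < n),
        orderStat v ⟨l + 1, hl⟩ ≤ orderStat v ⟨l, by omega⟩ + δ := by
      intro l hl
      have h1 := (le_ciSup (Set.finite_range fun i : Fin (n - 1) =>
        (orderStat v ⟨(i : ℕ) + 1, by omega⟩ - orderStat v ⟨(i : ℕ), by omega⟩)).bddAbove
        ⟨l, by omega⟩).trans h
      dsimp only at h1
      linarith
    -- the successor of the last order statistic not exceeding the `i`-th one lies in between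
    by_contra! hc
    have key : ∀ l, (hl : l < n) → (i : ℕ) ≤ l → orderStat v ⟨l, hl⟩ ≤ orderStat v i := by
      intro l
      induction l with
      | zero =>
        intro hl hil
        exact hmono (by simp [Fin.le_def])
      | succ l ih =>
        intro hl hil
        rcases Nat.lt_or_ge l i with h1 | h1
        · exact hmono (by simp [Fin.le_def]; omega)
        · have h2 := ih (by omega) h1
          by_contra! h3
          have h4 := hc _ ⟨⟨l + 1, hl⟩, rfl⟩ h3
          have h5 := hstep l hl
          linarith
    have hlt : i < j := by
      by_contra! h1
      have := hmono h1
      linarith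
    have := key j j.2 hlt.le
    have h6 : orderStat v j ≤ orderStat v i := this
    linarith
  · intro h
    rcases isEmpty_or_nonempty (Fin (n - 1)) with he | he
    · simpa [maxSpacing] using hδ
    · refine ciSup_le fun i => ?_
      by_contra! hi
      obtain ⟨_, ⟨k, rfl⟩, h1, h2⟩ := h _ ⟨_, rfl⟩ _ ⟨_, rfl⟩ (lt_sub_iff_add_lt'.1 hi)
      rcases Nat.lt_or_ge i k with hk | hk
      · have := hmono (show (⟨(i : ℕ) + 1, by omega⟩ : Fin n) ≤ k from Fin.le_def.2 hk)
        linarith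
      · have := hmono (show k ≤ (⟨(i : ℕ), by omega⟩ : Fin n) from Fin.le_def.2 hk)
        linarith

/-! ### The Gaussian tail -/

/-- The upper tail `Φ̄(t) = P(N > t)` of a standard normal variable. -/
noncomputable def gaussTail (t : ℝ) : ℝ := (gaussianReal 0 1).real (Set.Ioi t)

instance : NullSingletonClass (gaussianReal 0 1) := nullSingletonClass_gaussianReal one_ne_zero

lemma gaussTail_nonneg (t : ℝ) : 0 ≤ gaussTail t := measureReal_nonneg

lemma gaussTail_le_one (t : ℝ) : gaussTail t ≤ 1 := measureReal_le_one

lemma gaussTail_eq_integral (t : ℝ) :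
    gaussTail t = ∫ s in Set.Ioi t, gaussianPDFReal 0 1 s := by
  rw [gaussTail, measureReal_def, gaussianReal_apply_eq_integral _ one_ne_zero,
    ENNReal.toReal_ofReal]
  exact setIntegral_nonneg measurableSet_Ioi fun s _ => gaussianPDFReal_nonneg _ _ _

lemma gaussianPDFReal_std (s : ℝ) :
    gaussianPDFReal 0 1 s = (√(2 * Real.pi))⁻¹ * Real.exp (-s ^ 2 / 2) := by
  simp [gaussianPDFReal]

lemma gaussianPDFReal_std_add (s δ : ℝ) :
    gaussianPDFReal 0 1 (s + δ) =
      Real.exp (-(s * δ) - δ ^ 2 / 2) * gaussianPDFReal 0 1 s := by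
  rw [gaussianPDFReal_std, gaussianPDFReal_std, mul_left_comm, ← Real.exp_add]
  congr 2
  ring

lemma continuous_gaussianPDFReal_std : Continuous (gaussianPDFReal 0 1) := by
  have : gaussianPDFReal 0 1 = fun s => (√(2 * Real.pi))⁻¹ * Real.exp (-s ^ 2 / 2) :=
    funext gaussianPDFReal_std
  rw [this]
  fun_prop

lemma gaussTail_add_eq_integral (t δ : ℝ) :
    gaussTail (t + δ) = ∫ s in Set.Ioi t, gaussianPDFReal 0 1 (s + δ) := by
  rw [gaussTail_eq_integral]
  have := (measurePreserving_add_right (volume : Measure ℝ) δ).setIntegral_preimage_emb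
    (measurableEmbedding_addRight δ) (gaussianPDFReal 0 1) (Set.Ioi (t + δ))
  rw [← this]
  congr 2
  ext s
  simp

lemma gaussTail_add_le {t δ : ℝ} (hδ : 0 ≤ δ) :
    gaussTail (t + δ) ≤ Real.exp (-(t * δ) - δ ^ 2 / 2) * gaussTail t := by
  rw [gaussTail_add_eq_integral, gaussTail_eq_integral, ← integral_const_mul]
  refine setIntegral_mono_on ((integrable_gaussianPDFReal 0 1).comp_add_right δ).integrableOn
    ((integrable_gaussianPDFReal 0 1).integrableOn.const_mul _) measurableSet_Ioi fun s hs => ?_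
  rw [gaussianPDFReal_std_add]
  refine mul_le_mul_of_nonneg_right (Real.exp_le_exp.2 ?_) (gaussianPDFReal_nonneg _ _ _)
  nlinarith [Set.mem_Ioi.1 hs]

lemma gaussTail_le_exp {t : ℝ} (ht : 0 ≤ t) : gaussTail t ≤ Real.exp (-t ^ 2 / 2) := by
  have h := gaussTail_add_le (t := 0) ht
  have h1 := gaussTail_le_one 0
  have h2 := Real.exp_pos (-t ^ 2 / 2)
  simp only [zero_add, zero_mul, neg_zero, zero_sub] at h
  rw [neg_div]
  rw [neg_div] at h2
  nlinarith

lemma gaussianReal_real_Ioc {a b : ℝ} (h : a ≤ b) :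
    (gaussianReal 0 1).real (Set.Ioc a b) = gaussTail a - gaussTail b := by
  rw [gaussTail, gaussTail, ← measureReal_sdiff (Set.Ioi_subset_Ioi h) measurableSet_Ioi,
    Set.Ioi_sdiff_Ioi]

lemma gaussianReal_real_Ioc_eq {a b : ℝ} :
    (gaussianReal 0 1).real (Set.Ioc a b) = ∫ s in Set.Ioc a b, gaussianPDFReal 0 1 s := by
  rw [measureReal_def, gaussianReal_apply_eq_integral _ one_ne_zero, ENNReal.toReal_ofReal]
  exact setIntegral_nonneg measurableSet_Ioc fun s _ => gaussianPDFReal_nonneg _ _ _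

lemma gaussTail_sub_eq {a b : ℝ} (h : a ≤ b) :
    gaussTail a - gaussTail b = ∫ s in a..b, gaussianPDFReal 0 1 s := by
  rw [← gaussianReal_real_Ioc h, gaussianReal_real_Ioc_eq, intervalIntegral.integral_of_le h]

/-- The shift inequality opposite to `gaussTail_add_le`: the density ratio at `s ≤ T` is at least
`exp (-Tδ - δ²/2)`, and the mass beyond `T` is discarded. -/
lemma le_gaussTail_add {t T δ : ℝ} (hδ : 0 ≤ δ) (htT : t ≤ T) :
    Real.exp (-(T * δ) - δ ^ 2 / 2) * (gaussTail t - gaussTail T) ≤ gaussTail (t + δ) := by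
  rw [gaussTail_add_eq_integral, ← gaussianReal_real_Ioc htT, gaussianReal_real_Ioc_eq,
    ← integral_const_mul]
  calc ∫ s in Set.Ioc t T, Real.exp (-(T * δ) - δ ^ 2 / 2) * gaussianPDFReal 0 1 s
      ≤ ∫ s in Set.Ioc t T, gaussianPDFReal 0 1 (s + δ) := by
        refine setIntegral_mono_on ((integrable_gaussianPDFReal 0 1).integrableOn.const_mul _)
          ((integrable_gaussianPDFReal 0 1).comp_add_right δ).integrableOn measurableSet_Ioc
          fun s hs => ?_
        rw [gaussianPDFReal_std_add]
        refine mul_le_mul_of_nonneg_right (Real.exp_le_exp.2 ?_) (gaussianPDFReal_nonneg _ _ _)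
        nlinarith [hs.2]
    _ ≤ ∫ s in Set.Ioi t, gaussianPDFReal 0 1 (s + δ) :=
        setIntegral_mono_set ((integrable_gaussianPDFReal 0 1).comp_add_right δ).integrableOn
          (ae_of_all _ fun s => gaussianPDFReal_nonneg _ _ _)
          (Set.Ioc_subset_Ioi_self.eventuallyLE)

lemma le_gaussTail_sub {a b M : ℝ} (hab : a ≤ b) (ha : -M ≤ a) (hb : b ≤ M) :
    (b - a) * gaussianPDFReal 0 1 M ≤ gaussTail a - gaussTail b := by
  rw [gaussTail_sub_eq hab]
  have h : ∫ _ in a..b, gaussianPDFReal 0 1 M = (b - a) * gaussianPDFReal 0 1 M := by simp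
  rw [← h]
  refine intervalIntegral.integral_mono_on hab (by simp)
    (continuous_gaussianPDFReal_std.intervalIntegrable _ _) fun s hs => ?_
  rw [gaussianPDFReal_std, gaussianPDFReal_std]
  have : s ^ 2 ≤ M ^ 2 := sq_le_sq' (by linarith [hs.1]) (by linarith [hs.2])
  gcongr

lemma hasDerivAt_gaussTail (t : ℝ) : HasDerivAt gaussTail (-gaussianPDFReal 0 1 t) t := by
  have h1 : HasDerivAt (fun u => ∫ s in (t - 1)..u, gaussianPDFReal 0 1 s)
      (gaussianPDFReal 0 1 t) t :=
    intervalIntegral.integral_hasDerivAt_right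
      (continuous_gaussianPDFReal_std.intervalIntegrable _ _)
      (continuous_gaussianPDFReal_std.stronglyMeasurableAtFilter _ _)
      continuous_gaussianPDFReal_std.continuousAt
  refine (h1.const_sub (gaussTail (t - 1))).congr_of_eventuallyEq ?_
  filter_upwards [lt_mem_nhds (show t - 1 < t by linarith)] with u hu
  rw [← gaussTail_sub_eq hu.le]
  ring

lemma continuous_gaussTail : Continuous gaussTail :=
  continuous_iff_continuousAt.2 fun t => (hasDerivAt_gaussTail t).continuousAt

/-- The law of the minimum of `m + 1` independent standard normals: integrating over the position
of the minimum gives the increment of `Φ̄ ^ (m + 1)`. -/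
lemma integral_gaussTail_pow {a b : ℝ} (h : a ≤ b) (m : ℕ) :
    (m + 1) * ∫ s in Set.Ioc a b, gaussTail s ^ m ∂(gaussianReal 0 1) =
      gaussTail a ^ (m + 1) - gaussTail b ^ (m + 1) := by
  have hd : ∀ s, HasDerivAt (fun u => -gaussTail u ^ (m + 1))
      ((m + 1) * (gaussianPDFReal 0 1 s * gaussTail s ^ m)) s := by
    intro s
    refine ((hasDerivAt_gaussTail s).pow (m + 1)).neg.congr_deriv ?_
    push_cast
    ring
  have hc : Continuous fun s => ((m : ℝ) + 1) * (gaussianPDFReal 0 1 s * gaussTail s ^ m) := by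
    have := continuous_gaussianPDFReal_std
    have := continuous_gaussTail
    fun_prop
  have h1 := intervalIntegral.integral_eq_sub_of_hasDerivAt (fun s _ => hd s)
    (hc.intervalIntegrable a b)
  rw [intervalIntegral.integral_of_le h, integral_const_mul] at h1
  rw [← integral_indicator measurableSet_Ioc,
    integral_gaussianReal_eq_integral_smul one_ne_zero]
  have h2 : ∀ s, gaussianPDFReal 0 1 s • (Set.Ioc a b).indicator (fun s => gaussTail s ^ m) s =
      (Set.Ioc a b).indicator (fun s => gaussianPDFReal 0 1 s * gaussTail s ^ m) s := by
    intro s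
    by_cases hs : s ∈ Set.Ioc a b <;> simp [hs]
  simp only [h2]
  rw [integral_indicator measurableSet_Ioc, h1]
  ring

/-! ### Peeling off the minimum of a sample -/

/-- The law of a family of independent standard normal variables indexed by `κ`. -/
noncomputable abbrev stdGaussianPi (κ : Type*) [Fintype κ] : Measure (κ → ℝ) :=
  Measure.pi fun _ => gaussianReal 0 1

/-- Fubini, singling out the coordinate `i`. -/
lemma stdGaussianPi_real_single_out {m : ℕ} (i : Fin (m + 1)) {D : Set ℝ} (hD : MeasurableSet D)
    {B : Set (ℝ × (Fin m → ℝ))} (hB : MeasurableSet B) :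
    (stdGaussianPi (Fin (m + 1))).real
        {v | v i ∈ D ∧ (v i, fun j => v (i.succAbove j)) ∈ B} =
      ∫ s in D, (stdGaussianPi (Fin m)).real {w | (s, w) ∈ B} ∂(gaussianReal 0 1) := by
  have h1 := measurePreserving_piFinSuccAbove (fun _ : Fin (m + 1) => gaussianReal 0 1) i
  have hE : MeasurableSet ((Prod.fst ⁻¹' D) ∩ B) := (measurable_fst hD).inter hB
  have h2 := h1.measureReal_preimage hE.nullMeasurableSet
  have h3 : (MeasurableEquiv.piFinSuccAbove (fun _ => ℝ) i) ⁻¹' ((Prod.fst ⁻¹' D) ∩ B) =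
      {v | v i ∈ D ∧ (v i, fun j => v (i.succAbove j)) ∈ B} := rfl
  have h4 := integral_toReal (μ := (gaussianReal 0 1).restrict D)
    (f := fun s => stdGaussianPi (Fin m) {w | (s, w) ∈ B})
    (measurable_measure_prodMk_left hB).aemeasurable (ae_of_all _ fun s => measure_lt_top _ _)
  simp only [← measureReal_def] at h4
  rw [← h3, h2, measureReal_def, Measure.prod_apply hE, h4, ← lintegral_indicator hD]
  congr 2
  ext s
  by_cases hs : s ∈ D
  · rw [Set.indicator_of_mem hs]
    congr 1
    ext w
    simp [hs]
  · rw [Set.indicator_of_notMem hs]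
    have : Prod.mk s ⁻¹' (Prod.fst ⁻¹' D ∩ B) = (∅ : Set (Fin m → ℝ)) := by
      ext w
      simp [hs]
    rw [this, measure_empty]

/-- The samples all of whose points exceed `t` and which, together with `t`, have no gap longer
than `δ`. -/
def upChain (κ : Type*) (δ t : ℝ) : Set (κ → ℝ) :=
  {v | (∀ i, t < v i) ∧ GapFree δ (insert t (Set.range v))}

/-- The samples all of whose points lie in `[t, T]` and which, together with `t`, have no gap
longer than `δ`. In contrast to `upChain`, points equal to `t` are allowed: the two sets stand in
the opposite inclusions needed for lower and upper bounds, which makes a discussion of ties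
unnecessary. -/
def upChainUpTo (κ : Type*) (δ T t : ℝ) : Set (κ → ℝ) :=
  {v | (∀ i, v i ∈ Set.Icc t T) ∧ GapFree δ (insert t (Set.range v))}

lemma measurableSet_prod_upChain (κ : Type*) [Countable κ] (δ : ℝ) :
    MeasurableSet {p : ℝ × (κ → ℝ) | p.2 ∈ upChain κ δ p.1} := by
  refine MeasurableSet.inter (s₁ := {p : ℝ × (κ → ℝ) | ∀ i, p.1 < p.2 i})
    (s₂ := {p : ℝ × (κ → ℝ) | GapFree δ (insert p.1 (Set.range p.2))}) ?_
    (measurableSet_gapFree_insert δ measurable_fst fun i => by fun_prop)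
  simp only [Set.ofPred_forall]
  exact MeasurableSet.iInter fun i => measurableSet_lt (by fun_prop) (by fun_prop)

lemma measurableSet_prod_upChainUpTo (κ : Type*) [Countable κ] (δ T : ℝ) :
    MeasurableSet {p : ℝ × (κ → ℝ) | p.2 ∈ upChainUpTo κ δ T p.1} := by
  refine MeasurableSet.inter (s₁ := {p : ℝ × (κ → ℝ) | ∀ i, p.2 i ∈ Set.Icc p.1 T})
    (s₂ := {p : ℝ × (κ → ℝ) | GapFree δ (insert p.1 (Set.range p.2))}) ?_
    (measurableSet_gapFree_insert δ measurable_fst fun i => by fun_prop)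
  simp only [Set.ofPred_forall]
  exact MeasurableSet.iInter fun i =>
    (measurableSet_le (f := fun p : ℝ × (κ → ℝ) => p.1) (g := fun p => p.2 i)
      (by fun_prop) (by fun_prop)).inter
    (measurableSet_le (f := fun p : ℝ × (κ → ℝ) => p.2 i) (g := fun _ => T)
      (by fun_prop) (by fun_prop))

lemma Fin.range_eq_insert_succAbove {m : ℕ} (v : Fin (m + 1) → ℝ) (i : Fin (m + 1)) :
    Set.range v = insert (v i) (Set.range fun j => v (i.succAbove j)) := by
  ext z
  simp [i.exists_iff_succAbove, eq_comm]

/-- Peeling off the strict minimum of the sample, which may be any of the `m + 1` points. -/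
lemma le_upChain_succ {δ : ℝ} (t : ℝ) (hδ : 0 ≤ δ) (m : ℕ) :
    (m + 1) * ∫ s in Set.Ioc t (t + δ), (stdGaussianPi (Fin m)).real (upChain (Fin m) δ s)
        ∂(gaussianReal 0 1) ≤
      (stdGaussianPi (Fin (m + 1))).real (upChain (Fin (m + 1)) δ t) := by
  set F : Fin (m + 1) → Set (Fin (m + 1) → ℝ) := fun i =>
    {v | v i ∈ Set.Ioc t (t + δ) ∧ (v i, fun j => v (i.succAbove j)) ∈
      {p : ℝ × (Fin m → ℝ) | p.2 ∈ upChain (Fin m) δ p.1}} with hF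
  have hFr : ∀ i, (stdGaussianPi (Fin (m + 1))).real (F i) =
      ∫ s in Set.Ioc t (t + δ), (stdGaussianPi (Fin m)).real (upChain (Fin m) δ s)
        ∂(gaussianReal 0 1) := fun i =>
    stdGaussianPi_real_single_out i measurableSet_Ioc (measurableSet_prod_upChain _ δ)
  have hFm : ∀ i, MeasurableSet (F i) := fun i =>
    ((measurable_pi_apply i) measurableSet_Ioc).inter
      ((show Measurable fun v : Fin (m + 1) → ℝ => (v i, fun j => v (i.succAbove j)) by
        fun_prop) (measurableSet_prod_upChain _ δ))
  have hdisj : Pairwise (Function.onFun Disjoint F) := by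
    intro i j hij
    refine Set.disjoint_left.2 fun v hi hj => ?_
    obtain ⟨k, rfl⟩ := Fin.exists_succAbove_eq hij.symm
    obtain ⟨l, hl⟩ := Fin.exists_succAbove_eq hij
    have h1 := hi.2.1 k
    have h2 := hj.2.1 l
    dsimp only at h1 h2
    rw [hl] at h2
    exact lt_asymm h1 h2
  have hsub : (⋃ i, F i) ⊆ upChain (Fin (m + 1)) δ t := by
    intro v hv
    obtain ⟨i, ⟨⟨hi1, hi2⟩, hi3, hi4⟩⟩ := Set.mem_iUnion.1 hv
    dsimp only at hi3 hi4
    have hall : ∀ j, v i ≤ v j := i.forall_iff_succAbove.2 ⟨le_rfl, fun j => (hi3 j).le⟩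
    rw [← Fin.range_eq_insert_succAbove v i] at hi4
    refine ⟨fun j => hi1.trans_le (hall j), ?_⟩
    intro a ha b hb hab
    have hb' : b ∈ Set.range v := by
      rcases hb with rfl | hb
      · rcases ha with rfl | ⟨j, rfl⟩
        · linarith
        · have := hall j
          linarith
      · exact hb
    rcases ha with rfl | ha
    · exact ⟨v i, Or.inr ⟨i, rfl⟩, hi1, by linarith⟩
    · obtain ⟨c, hc, h1, h2⟩ := hi4 a ha b hb' hab
      exact ⟨c, Or.inr hc, h1, h2⟩
  refine le_trans (le_of_eq ?_) (measureReal_mono hsub)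
  rw [measureReal_iUnion_fintype hdisj hFm]
  simp [hFr]

/-- Peeling off a minimum of the sample, which may be any of the `m + 1` points. -/
lemma upChainUpTo_succ_le (δ T t : ℝ) (m : ℕ) :
    (stdGaussianPi (Fin (m + 1))).real (upChainUpTo (Fin (m + 1)) δ T t) ≤
    (m + 1) * ∫ s in Set.Icc t (min (t + δ) T),
      (stdGaussianPi (Fin m)).real (upChainUpTo (Fin m) δ T s) ∂(gaussianReal 0 1) := by
  set F : Fin (m + 1) → Set (Fin (m + 1) → ℝ) := fun i =>
    {v | v i ∈ Set.Icc t (min (t + δ) T) ∧ (v i, fun j => v (i.succAbove j)) ∈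
      {p : ℝ × (Fin m → ℝ) | p.2 ∈ upChainUpTo (Fin m) δ T p.1}} with hF
  have hFr : ∀ i, (stdGaussianPi (Fin (m + 1))).real (F i) =
      ∫ s in Set.Icc t (min (t + δ) T),
        (stdGaussianPi (Fin m)).real (upChainUpTo (Fin m) δ T s) ∂(gaussianReal 0 1) := fun i =>
    stdGaussianPi_real_single_out i measurableSet_Icc (measurableSet_prod_upChainUpTo _ δ T)
  have hsub : upChainUpTo (Fin (m + 1)) δ T t ⊆ ⋃ i, F i := by
    intro v ⟨hv1, hv2⟩
    obtain ⟨i, hi⟩ := Finite.exists_min v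
    have hle : v i ≤ t + δ := by
      by_contra! h
      obtain ⟨c, hc, h1, h2⟩ := hv2 t (Set.mem_insert _ _) (v i) (Or.inr ⟨i, rfl⟩) h
      rcases hc with rfl | ⟨j, rfl⟩
      · exact lt_irrefl _ h1
      · exact (hi j).not_gt h2
    refine Set.mem_iUnion.2 ⟨i, ⟨(hv1 i).1, le_min hle (hv1 i).2⟩, ?_⟩
    refine ⟨fun j => ⟨hi _, (hv1 _).2⟩, ?_⟩
    dsimp only
    rw [← Fin.range_eq_insert_succAbove v i]
    intro a ha b hb hab
    obtain ⟨c, hc, h1, h2⟩ := hv2 a (Or.inr ha) b (Or.inr hb) hab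
    rcases hc with rfl | hc
    · obtain ⟨j, rfl⟩ := ha
      exact absurd h1 (not_lt.2 (hv1 j).1)
    · exact ⟨c, hc, h1, h2⟩
  refine (measureReal_mono hsub).trans ((measureReal_iUnion_fintype_le F).trans (le_of_eq ?_))
  simp [hFr]

lemma integrable_upChain (m : ℕ) (δ : ℝ) :
    Integrable (fun s => (stdGaussianPi (Fin m)).real (upChain (Fin m) δ s))
      (gaussianReal 0 1) := by
  refine Integrable.of_bound
    (measurable_measure_prodMk_left (measurableSet_prod_upChain (Fin m)
      δ)).ennreal_toReal.aestronglyMeasurable 1 (ae_of_all _ fun s => ?_)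
  rw [Real.norm_of_nonneg measureReal_nonneg]
  exact measureReal_le_one

lemma integrable_upChainUpTo (m : ℕ) (δ T : ℝ) :
    Integrable (fun s => (stdGaussianPi (Fin m)).real (upChainUpTo (Fin m) δ T s))
      (gaussianReal 0 1) := by
  refine Integrable.of_bound
    (measurable_measure_prodMk_left (measurableSet_prod_upChainUpTo (Fin m)
      δ T)).ennreal_toReal.aestronglyMeasurable 1 (ae_of_all _ fun s => ?_)
  rw [Real.norm_of_nonneg measureReal_nonneg]
  exact measureReal_le_one

lemma integrable_gaussTail_pow (m : ℕ) (c : ℝ) :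
    Integrable (fun s => c * gaussTail s ^ m) (gaussianReal 0 1) := by
  refine (Integrable.of_bound (C := 1) (continuous_gaussTail.pow m).aestronglyMeasurable
    (ae_of_all _ fun s => ?_)).const_mul c
  rw [Pi.pow_apply, Real.norm_of_nonneg (pow_nonneg (gaussTail_nonneg s) m)]
  exact pow_le_one₀ (gaussTail_nonneg s) (gaussTail_le_one s)

/-- If `Φ̄(t + δ) ≤ ρ Φ̄(t)` for all `t ≥ t₀`, then, conditionally on exceeding `t ≥ t₀`, a sample
of size `m` is free of gaps longer than `δ` with probability at least `∏_{j ≤ m} (1 - ρ ^ j)`: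
the lowest of `j` points above `s` lies in `(s, s + δ]` with probability `≥ 1 - ρ ^ j`. -/
lemma le_upChain {δ t₀ ρ : ℝ} (hδ : 0 ≤ δ) (hρ0 : 0 ≤ ρ) (hρ1 : ρ ≤ 1)
    (hρ : ∀ t, t₀ ≤ t → gaussTail (t + δ) ≤ ρ * gaussTail t) (m : ℕ) :
    ∀ t, t₀ ≤ t → (∏ j ∈ Finset.range m, (1 - ρ ^ (j + 1))) * gaussTail t ^ m ≤
      (stdGaussianPi (Fin m)).real (upChain (Fin m) δ t) := by
  induction m with
  | zero =>
    intro t _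
    have : upChain (Fin 0) δ t = Set.univ := by
      refine Set.eq_univ_of_forall fun v => ⟨fun i => i.elim0, ?_⟩
      intro a ha b hb hab
      simp only [Set.range_eq_empty, insert_empty_eq, Set.mem_singleton_iff] at ha hb
      linarith
    simp [this]
  | succ m ih =>
    intro t ht
    set c := ∏ j ∈ Finset.range m, (1 - ρ ^ (j + 1)) with hc
    have hc0 : 0 ≤ c := Finset.prod_nonneg fun j _ => sub_nonneg.2 (pow_le_one₀ hρ0 hρ1)
    refine le_trans ?_ (le_upChain_succ t hδ m)
    have h1 : ∫ s in Set.Ioc t (t + δ), c * gaussTail s ^ m ∂(gaussianReal 0 1) ≤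
        ∫ s in Set.Ioc t (t + δ), (stdGaussianPi (Fin m)).real (upChain (Fin m) δ s)
          ∂(gaussianReal 0 1) :=
      setIntegral_mono_on (integrable_gaussTail_pow m c).integrableOn
        (integrable_upChain m δ).integrableOn measurableSet_Ioc
        fun s hs => ih s (ht.trans hs.1.le)
    rw [integral_const_mul] at h1
    have h2 := integral_gaussTail_pow (show t ≤ t + δ by linarith) m
    have h3 : gaussTail (t + δ) ^ (m + 1) ≤ ρ ^ (m + 1) * gaussTail t ^ (m + 1) := by
      rw [← mul_pow]
      exact pow_le_pow_left₀ (gaussTail_nonneg _) (hρ t ht) _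
    rw [Finset.prod_range_succ, ← hc]
    calc c * (1 - ρ ^ (m + 1)) * gaussTail t ^ (m + 1)
        ≤ c * (gaussTail t ^ (m + 1) - gaussTail (t + δ) ^ (m + 1)) := by
          rw [mul_assoc]
          exact mul_le_mul_of_nonneg_left (by linarith) hc0
      _ = (m + 1) * (c * ∫ s in Set.Ioc t (t + δ), gaussTail s ^ m ∂(gaussianReal 0 1)) := by
          rw [← h2]
          ring
      _ ≤ _ := mul_le_mul_of_nonneg_left h1 (by positivity)

/-- If `ρ Φ̄(t) ≤ Φ̄(t + δ)` for all `t ∈ [t₀, T]`, then, conditionally on exceeding `t ∈ [t₀, T]`,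
a sample of size `m` stays below `T` and is free of gaps longer than `δ` with probability at most
`∏_{j ≤ m} (1 - ρ ^ j)`. -/
lemma upChainUpTo_le {δ t₀ T ρ : ℝ} (hδ : 0 ≤ δ) (hρ0 : 0 ≤ ρ) (hρ1 : ρ ≤ 1)
    (hρ : ∀ t, t₀ ≤ t → t ≤ T → ρ * gaussTail t ≤ gaussTail (t + δ)) (m : ℕ) :
    ∀ t, t₀ ≤ t → t ≤ T → (stdGaussianPi (Fin m)).real (upChainUpTo (Fin m) δ T t) ≤
      (∏ j ∈ Finset.range m, (1 - ρ ^ (j + 1))) * gaussTail t ^ m := by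
  induction m with
  | zero =>
    intro t _ _
    simp
  | succ m ih =>
    intro t ht htT
    set c := ∏ j ∈ Finset.range m, (1 - ρ ^ (j + 1)) with hc
    have hc0 : 0 ≤ c := Finset.prod_nonneg fun j _ => sub_nonneg.2 (pow_le_one₀ hρ0 hρ1)
    refine (upChainUpTo_succ_le δ T t m).trans ?_
    have h1 : ∫ s in Set.Icc t (min (t + δ) T),
        (stdGaussianPi (Fin m)).real (upChainUpTo (Fin m) δ T s) ∂(gaussianReal 0 1) ≤
        ∫ s in Set.Icc t (min (t + δ) T), c * gaussTail s ^ m ∂(gaussianReal 0 1) :=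
      setIntegral_mono_on (integrable_upChainUpTo m δ T).integrableOn
        (integrable_gaussTail_pow m c).integrableOn measurableSet_Icc
        fun s hs => ih s (ht.trans hs.1) (hs.2.trans (min_le_right _ _))
    have h1' : ∫ s in Set.Icc t (min (t + δ) T), c * gaussTail s ^ m ∂(gaussianReal 0 1) ≤
        ∫ s in Set.Ioc t (t + δ), c * gaussTail s ^ m ∂(gaussianReal 0 1) := by
      rw [integral_Icc_eq_integral_Ioc]
      refine setIntegral_mono_set (integrable_gaussTail_pow m c).integrableOn
        (ae_of_all _ fun s => ?_)
        (Set.Ioc_subset_Ioc_right (min_le_left _ _)).eventuallyLE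
      have := gaussTail_nonneg s
      change 0 ≤ c * gaussTail s ^ m
      positivity
    replace h1 := h1.trans h1'
    rw [integral_const_mul] at h1
    have h2 := integral_gaussTail_pow (show t ≤ t + δ by linarith) m
    have h3 : ρ ^ (m + 1) * gaussTail t ^ (m + 1) ≤ gaussTail (t + δ) ^ (m + 1) := by
      rw [← mul_pow]
      exact pow_le_pow_left₀ (mul_nonneg hρ0 (gaussTail_nonneg _)) (hρ t ht htT) _
    rw [Finset.prod_range_succ, ← hc]
    calc _ ≤ (m + 1) * (c * ∫ s in Set.Ioc t (t + δ), gaussTail s ^ m ∂(gaussianReal 0 1)) :=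
          mul_le_mul_of_nonneg_left h1 (by positivity)
      _ = c * (gaussTail t ^ (m + 1) - gaussTail (t + δ) ^ (m + 1)) := by
          rw [← h2]
          ring
      _ ≤ c * (1 - ρ ^ (m + 1)) * gaussTail t ^ (m + 1) := by
          rw [mul_assoc]
          exact mul_le_mul_of_nonneg_left (by linarith) hc0

/-! ### Splitting a sample at a level -/

section Relabel

variable {κ κ' : Type*}

lemma range_piCongrLeft (e : κ ≃ κ') (v : κ → ℝ) :
    Set.range (MeasurableEquiv.piCongrLeft (fun _ => ℝ) e v) = Set.range v := by
  rw [← e.surjective.range_comp]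
  congr 1
  ext i
  exact Equiv.piCongrLeft_apply_apply (fun _ => ℝ) e v i

variable [Fintype κ] [Fintype κ']

lemma stdGaussianPi_real_preimage_piCongrLeft (e : κ ≃ κ') (A : Set (κ' → ℝ)) :
    (stdGaussianPi κ).real (MeasurableEquiv.piCongrLeft (fun _ => ℝ) e ⁻¹' A) =
      (stdGaussianPi κ').real A := by
  rw [measureReal_def, measureReal_def,
    (measurePreserving_piCongrLeft (fun _ : κ' => gaussianReal 0 1) e).measure_preimage_equiv]

lemma stdGaussianPi_real_upChain_congr (e : κ ≃ κ') (δ t : ℝ) :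
    (stdGaussianPi κ).real (upChain κ δ t) = (stdGaussianPi κ').real (upChain κ' δ t) := by
  rw [← stdGaussianPi_real_preimage_piCongrLeft e]
  congr 1
  ext v
  have h := range_piCongrLeft e v
  simp only [upChain, Set.mem_preimage, Set.mem_ofPred_eq, h]
  rw [← Set.forall_mem_range (f := v) (p := fun z => t < z), ← h, Set.forall_mem_range]

lemma stdGaussianPi_real_upChainUpTo_congr (e : κ ≃ κ') (δ T t : ℝ) :
    (stdGaussianPi κ).real (upChainUpTo κ δ T t) =
      (stdGaussianPi κ').real (upChainUpTo κ' δ T t) := by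
  rw [← stdGaussianPi_real_preimage_piCongrLeft e]
  congr 1
  ext v
  have h := range_piCongrLeft e v
  simp only [upChainUpTo, Set.mem_preimage, Set.mem_ofPred_eq, h]
  rw [← Set.forall_mem_range (f := v) (p := fun z => z ∈ Set.Icc t T), ← h, Set.forall_mem_range]

end Relabel

section Split

variable {ι : Type*} [Fintype ι]

/-- The indices of the sample points exceeding `t`. -/
noncomputable def exceedSet (t : ℝ) (v : ι → ℝ) : Finset ι := {i | t < v i}

lemma mem_exceedSet {t : ℝ} {v : ι → ℝ} {i : ι} : i ∈ exceedSet t v ↔ t < v i := by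
  simp [exceedSet]

lemma measurableSet_exceedSet_eq (t : ℝ) (S : Finset ι) :
    MeasurableSet {v : ι → ℝ | exceedSet t v = S} := by
  simp only [Finset.ext_iff, mem_exceedSet, Set.ofPred_forall]
  refine MeasurableSet.iInter fun i => ?_
  have h : MeasurableSet {v : ι → ℝ | t < v i} := measurableSet_lt (by fun_prop) (by fun_prop)
  by_cases hi : i ∈ S
  · simpa [hi] using h
  · simp only [hi, iff_false]
    exact h.compl

/-- The property `Q` of samples depends only on which points exceed `t` and on the positions of the
points not exceeding `t`. -/
def DependsOnBelow (t : ℝ) (Q : (ι → ℝ) → Prop) : Prop :=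
  ∀ v w : ι → ℝ, exceedSet t v = exceedSet t w → (∀ i, v i ≤ t → v i = w i) → Q v → Q w

lemma range_inter_Ioi {t : ℝ} {v : ι → ℝ} {S : Finset ι} (h : exceedSet t v = S) :
    Set.range v ∩ Set.Ioi t = Set.range fun i : S => v i := by
  subst h
  ext z
  constructor
  · rintro ⟨⟨i, rfl⟩, hi⟩
    exact ⟨⟨i, mem_exceedSet.2 hi⟩, rfl⟩
  · rintro ⟨i, rfl⟩
    exact ⟨⟨i, rfl⟩, mem_exceedSet.1 i.2⟩

/-- Given the set `S` of indices of points exceeding `t`, the points with index in `S` are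
independent of the others. -/
lemma stdGaussianPi_real_fiber [DecidableEq ι] {t : ℝ} {Q : (ι → ℝ) → Prop} (hQ : DependsOnBelow t Q)
    (S : Finset ι) (A : Set (S → ℝ)) :
    (stdGaussianPi ι).real
        ({v | (fun i : S => v i) ∈ A ∧ Q v} ∩ {v | exceedSet t v = S}) =
      (stdGaussianPi S).real (A ∩ {w | ∀ i, t < w i}) *
        (stdGaussianPi {i // i ∉ S}).real
          ((fun (v : ι → ℝ) (i : {i // i ∉ S}) => v i) '' {v | exceedSet t v = S ∧ Q v}) := by
  set C := (fun (v : ι → ℝ) (i : {i // i ∉ S}) => v i) '' {v | exceedSet t v = S ∧ Q v} with hC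
  have h1 := (measurePreserving_piEquivPiSubtypeProd (fun _ : ι => gaussianReal 0 1)
    (fun i => i ∈ S)).measure_preimage_equiv ((A ∩ {w | ∀ i, t < w i}) ×ˢ C)
  rw [Measure.prod_prod] at h1
  simp only [measureReal_def]
  rw [← ENNReal.toReal_mul]
  congr 1
  refine Eq.trans ?_ (h1.trans (by congr!))
  congr 1
  ext v
  constructor
  · rintro ⟨⟨hA, hv⟩, hS⟩
    refine ⟨⟨hA, fun i => ?_⟩, ⟨v, ⟨hS, hv⟩, rfl⟩⟩
    have : (i : ι) ∈ exceedSet t v := by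
      rw [show exceedSet t v = S from hS]
      exact i.2
    exact (mem_exceedSet (t := t) (v := v)).1 this
  · rintro ⟨⟨hA, hgt⟩, w, ⟨hS, hw⟩, hwv⟩
    have hwv' : ∀ i, i ∉ S → w i = v i := fun i hi => congrFun hwv ⟨i, hi⟩
    have hS' : exceedSet t v = S := by
      ext i
      by_cases hi : i ∈ S
      · simpa [hi, mem_exceedSet] using hgt ⟨i, hi⟩
      · have h2 : i ∉ exceedSet t w := by rwa [hS]
        rw [mem_exceedSet, hwv' i hi] at h2
        simpa [hi, mem_exceedSet] using h2
    refine ⟨⟨hA, hQ w v (hS.trans hS'.symm) (fun i hi => hwv' i ?_) hw⟩, hS'⟩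
    rw [← hS, mem_exceedSet]
    exact hi.not_gt

lemma stdGaussianPi_real_forall_lt {κ : Type*} [Fintype κ] (t : ℝ) :
    (stdGaussianPi κ).real {w | ∀ i, t < w i} = gaussTail t ^ Fintype.card κ := by
  have : {w : κ → ℝ | ∀ i, t < w i} = Set.univ.pi fun _ => Set.Ioi t := by
    ext w
    simp
  rw [this, measureReal_def, Measure.pi_pi, gaussTail, measureReal_def]
  simp

lemma measureReal_eq_sum_exceedSet (μ : Measure (ι → ℝ)) [IsFiniteMeasure μ] (t : ℝ)
    (E : Set (ι → ℝ)) :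
    μ.real E = ∑ S : Finset ι, μ.real (E ∩ {v | exceedSet t v = S}) := by
  have h1 : (μ.restrict E).real Set.univ =
      ∑ S : Finset ι, (μ.restrict E).real {v | exceedSet t v = S} := by
    rw [← measureReal_iUnion_fintype]
    · congr 1
      ext v
      simp
    · intro S S' h
      refine Set.disjoint_left.2 fun v hv hv' => h ?_
      exact hv.symm.trans hv'
    · exact measurableSet_exceedSet_eq t
  rw [measureReal_restrict_apply_univ] at h1
  rw [h1]
  refine Finset.sum_congr rfl fun S _ => ?_
  rw [measureReal_restrict_apply (measurableSet_exceedSet_eq t S), Set.inter_comm]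

/-- The part of the sample above `t` has, together with `t`, no gap longer than `δ`. -/
def GapFreeAbove (δ t : ℝ) (v : ι → ℝ) : Prop := GapFree δ (insert t (Set.range v ∩ Set.Ioi t))

/-- At least `k` points of the sample exceed `t`; they are all at most `T` and have, together with
`t`, no gap longer than `δ`. -/
def ChainAbove (δ T t : ℝ) (k : ℕ) (v : ι → ℝ) : Prop :=
  GapFreeAbove δ t v ∧ (∀ z ∈ Set.range v ∩ Set.Ioi t, z ≤ T) ∧ k ≤ (exceedSet t v).card

lemma le_gapFreeAbove_and {δ t c : ℝ} {Q : (ι → ℝ) → Prop} (hQ : DependsOnBelow t Q)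
    (hc : ∀ S : Finset ι, c * gaussTail t ^ S.card ≤
      (stdGaussianPi S).real (upChain S δ t)) :
    c * (stdGaussianPi ι).real {v | Q v} ≤
      (stdGaussianPi ι).real {v | GapFreeAbove δ t v ∧ Q v} := by
  classical
  rw [measureReal_eq_sum_exceedSet _ t, measureReal_eq_sum_exceedSet _ t, Finset.mul_sum]
  refine Finset.sum_le_sum fun S _ => ?_
  have h1 := stdGaussianPi_real_fiber hQ S Set.univ
  have h2 := stdGaussianPi_real_fiber hQ S (upChain S δ t)
  rw [Set.univ_inter, stdGaussianPi_real_forall_lt, Fintype.card_coe] at h1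
  rw [Set.inter_eq_left.2 (show upChain S δ t ⊆ {w | ∀ i, t < w i} from fun w hw => hw.1)] at h2
  have h3 : {v : ι → ℝ | Q v} ∩ {v | exceedSet t v = S} =
      {v | (fun i : S => v i) ∈ Set.univ ∧ Q v} ∩ {v | exceedSet t v = S} := by simp
  have h4 : {v : ι → ℝ | GapFreeAbove δ t v ∧ Q v} ∩ {v | exceedSet t v = S} =
      {v | (fun i : S => v i) ∈ upChain S δ t ∧ Q v} ∩ {v | exceedSet t v = S} := by
    ext v
    simp only [Set.mem_inter_iff, Set.mem_ofPred_eq]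
    refine and_congr_left fun hS => and_congr_left fun _ => ?_
    rw [GapFreeAbove, range_inter_Ioi hS, upChain, Set.mem_ofPred_eq]
    refine ⟨fun h => ⟨fun i => ?_, h⟩, fun h => h.2⟩
    rw [← mem_exceedSet, hS]
    exact i.2
  rw [h3, h4, h1, h2, ← mul_assoc]
  exact mul_le_mul_of_nonneg_right (hc S) measureReal_nonneg

lemma chainAbove_and_le {δ t T c : ℝ} {k : ℕ} {Q : (ι → ℝ) → Prop} (hQ : DependsOnBelow t Q)
    (hc0 : 0 ≤ c)
    (hc : ∀ S : Finset ι, k ≤ S.card →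
      (stdGaussianPi S).real (upChainUpTo S δ T t) ≤ c * gaussTail t ^ S.card) :
    (stdGaussianPi ι).real {v | ChainAbove δ T t k v ∧ Q v} ≤ c * (stdGaussianPi ι).real {v | Q v} := by
  classical
  rw [measureReal_eq_sum_exceedSet _ t,
    measureReal_eq_sum_exceedSet _ t {v : ι → ℝ | Q v}, Finset.mul_sum]
  refine Finset.sum_le_sum fun S _ => ?_
  rcases Nat.lt_or_ge S.card k with hS | hS
  · refine le_trans (le_of_eq ?_) (mul_nonneg hc0 measureReal_nonneg)
    convert measureReal_empty
    ext v
    simp only [Set.mem_inter_iff, Set.mem_ofPred_eq, Set.mem_empty_iff_false, iff_false]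
    rintro ⟨⟨⟨_, _, h⟩, _⟩, rfl⟩
    exact hS.not_ge h
  have h1 := stdGaussianPi_real_fiber hQ S Set.univ
  have h2 := stdGaussianPi_real_fiber hQ S (upChainUpTo S δ T t)
  rw [Set.univ_inter, stdGaussianPi_real_forall_lt, Fintype.card_coe] at h1
  have h3 : {v : ι → ℝ | Q v} ∩ {v | exceedSet t v = S} =
      {v | (fun i : S => v i) ∈ Set.univ ∧ Q v} ∩ {v | exceedSet t v = S} := by simp
  have h4 : {v : ι → ℝ | ChainAbove δ T t k v ∧ Q v} ∩
        {v | exceedSet t v = S} ⊆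
      {v | (fun i : S => v i) ∈ upChainUpTo S δ T t ∧ Q v} ∩ {v | exceedSet t v = S} := by
    rintro v ⟨⟨⟨hv1, hv2, _⟩, hv3⟩, hv4⟩
    have hv4' : exceedSet t v = S := hv4
    refine ⟨⟨⟨fun i => ?_, ?_⟩, hv3⟩, hv4⟩
    · have hi : t < v i := by
        rw [← mem_exceedSet, hv4']
        exact i.2
      exact ⟨hi.le, hv2 _ ⟨⟨i, rfl⟩, hi⟩⟩
    · rwa [GapFreeAbove, range_inter_Ioi hv4'] at hv1
  rw [h3, h1, ← mul_assoc]
  refine (measureReal_mono h4).trans ?_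
  rw [h2]
  refine mul_le_mul_of_nonneg_right ?_ measureReal_nonneg
  exact (measureReal_mono Set.inter_subset_left).trans (hc S hS)

/-- The standard Gaussian law is invariant under reflection. -/
lemma stdGaussianPi_real_neg (Q : (ι → ℝ) → Prop) :
    (stdGaussianPi ι).real {v | Q (-v)} = (stdGaussianPi ι).real {v | Q v} := by
  have h0 : MeasurePreserving (MeasurableEquiv.neg ℝ) (gaussianReal 0 1) (gaussianReal 0 1) := by
    refine ⟨measurable_neg, ?_⟩
    have := gaussianReal_map_neg (μ := 0) (v := 1)
    rwa [neg_zero] at this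
  have h1 : MeasurePreserving (MeasurableEquiv.neg (ι → ℝ)) (stdGaussianPi ι)
      (stdGaussianPi ι) :=
    measurePreserving_pi _ _ fun _ => h0
  rw [measureReal_def, measureReal_def]
  congr 1
  exact h1.measure_preimage_equiv {v | Q v}

lemma dependsOnBelow_neg {t : ℝ} (ht : 0 ≤ t) {Q : Set ℝ → Finset ι → Prop} :
    DependsOnBelow t fun v : ι → ℝ => Q (Set.range (-v) ∩ Set.Ioi t) (exceedSet t (-v)) := by
  intro v w hvw hle hQ
  have hiff : ∀ i, t < (-v) i ↔ t < (-w) i := by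
    intro i
    by_cases hi : t < v i
    · have hi' : t < w i := by rwa [← mem_exceedSet, ← hvw, mem_exceedSet]
      simp only [Pi.neg_apply]
      constructor <;> intro h <;> linarith
    · simp [hle i (not_lt.1 hi)]
  have h1 : exceedSet t (-v) = exceedSet t (-w) := by
    ext i
    rw [mem_exceedSet, mem_exceedSet, hiff]
  have heq : ∀ i, t < (-v) i → (-v) i = (-w) i := by
    intro i hi
    simp only [Pi.neg_apply] at hi ⊢
    rw [hle i (by linarith)]
  have h2 : Set.range (-v) ∩ Set.Ioi t = Set.range (-w) ∩ Set.Ioi t := by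
    ext z
    constructor
    · rintro ⟨⟨i, rfl⟩, hi⟩
      exact ⟨⟨i, (heq i hi).symm⟩, hi⟩
    · rintro ⟨⟨i, rfl⟩, hi⟩
      exact ⟨⟨i, heq i ((hiff i).2 hi)⟩, hi⟩
  rwa [← h1, ← h2]

end Split

/-! ### Two-sided bounds for a finite sample -/

lemma antitone_prod_one_sub_pow {ρ : ℝ} (hρ0 : 0 ≤ ρ) (hρ1 : ρ ≤ 1) :
    Antitone fun k : ℕ => ∏ j ∈ Finset.range k, (1 - ρ ^ (j + 1)) := by
  refine antitone_nat_of_succ_le fun k => ?_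
  rw [Finset.prod_range_succ]
  have h : 0 ≤ ρ ^ (k + 1) := pow_nonneg hρ0 _
  exact mul_le_of_le_one_right
    (Finset.prod_nonneg fun j _ => sub_nonneg.2 (pow_le_one₀ hρ0 hρ1)) (by linarith)

section Combine

variable {ι : Type*}

/-- Every open interval of length `δ` starting in `[-τ, τ]` contains a sample point. -/
def FullUpTo (δ τ : ℝ) (v : ι → ℝ) : Prop := ∀ y, |y| ≤ τ → ∃ i, y < v i ∧ v i < y + δ

lemma gapFree_range_of_full {δ t τ : ℝ} {v : ι → ℝ} (ht : 0 ≤ t) (hδ : 0 ≤ δ) (hτ : t + δ ≤ τ)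
    (hfull : FullUpTo δ τ v) (hup : GapFreeAbove δ t v) (hlo : GapFreeAbove δ t (-v)) :
    GapFree δ (Set.range v) := by
  rintro _ ⟨i, rfl⟩ _ ⟨j, rfl⟩ hij
  rcases lt_or_ge t (v i) with hi | hi
  · obtain ⟨c, hc, h1, h2⟩ := hup (v i) (Or.inr ⟨⟨i, rfl⟩, hi⟩) (v j)
      (Or.inr ⟨⟨j, rfl⟩, by simp only [Set.mem_Ioi]; linarith⟩) hij
    rcases hc with rfl | hc
    · exact absurd h1 hi.not_gt
    · exact ⟨c, hc.1, h1, h2⟩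
  rcases lt_or_ge (v j) (-t) with hj | hj
  · obtain ⟨c, hc, h1, h2⟩ := hlo (-v j)
      (Or.inr ⟨⟨j, rfl⟩, by simp only [Set.mem_Ioi]; linarith⟩) (-v i)
      (Or.inr ⟨⟨i, rfl⟩, by simp only [Set.mem_Ioi]; linarith⟩) (by linarith)
    rcases hc with rfl | ⟨⟨l, rfl⟩, hl⟩
    · linarith
    · simp only [Pi.neg_apply] at h1 h2
      exact ⟨v l, ⟨l, rfl⟩, by linarith, by linarith⟩
  · obtain ⟨l, h1, h2⟩ := hfull (max (v i) (-τ))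
      (abs_le.2 ⟨le_max_right _ _, max_le (by linarith) (by linarith)⟩)
    refine ⟨v l, ⟨l, rfl⟩, (le_max_left _ _).trans_lt h1, ?_⟩
    rcases max_cases (v i) (-τ) with ⟨h3, _⟩ | ⟨h3, _⟩ <;> rw [h3] at h2 <;> linarith

variable [Fintype ι]

lemma chainAbove_of_full {δ t τ T : ℝ} {k : ℕ} {v : ι → ℝ} (hδ : 0 ≤ δ) (hk : 1 ≤ k)
    (hτ : t + k * δ ≤ τ)
    (hfull : ∀ y, t ≤ y → y + δ ≤ τ → ∃ i, y < v i ∧ v i < y + δ) (hT : ∀ i, v i ≤ T)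
    (h : GapFree δ (Set.range v)) : ChainAbove δ T t k v := by
  refine ⟨?_, ?_, ?_⟩
  · intro a ha b hb hab
    have hat : t ≤ a := by
      rcases ha with rfl | ha
      · exact le_rfl
      · exact (Set.mem_Ioi.1 ha.2).le
    have hb' : b ∈ Set.range v := by
      rcases hb with rfl | hb
      · linarith
      · exact hb.1
    rcases ha with rfl | ha
    · have h1 : (1 : ℝ) ≤ k := by exact_mod_cast hk
      obtain ⟨i, h1, h2⟩ := hfull a le_rfl (by nlinarith)
      exact ⟨v i, Or.inr ⟨⟨i, rfl⟩, h1⟩, h1, by linarith⟩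
    · obtain ⟨c, hc, h1, h2⟩ := h a ha.1 b hb' hab
      exact ⟨c, Or.inr ⟨hc, hat.trans_lt h1⟩, h1, h2⟩
  · rintro _ ⟨⟨i, rfl⟩, _⟩
    exact hT i
  · have hex : ∀ j : Fin k, ∃ i, t + j * δ < v i ∧ v i < t + j * δ + δ := by
      intro j
      have h1 : ((j : ℕ) : ℝ) + 1 ≤ k := by exact_mod_cast j.2
      refine hfull _ ?_ ?_
      · have : (0 : ℝ) ≤ (j : ℕ) * δ := by positivity
        linarith
      · nlinarith
    choose f hf1 hf2 using hex
    have hinj : Function.Injective f := by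
      refine Function.Injective.of_lt_imp_ne fun j l hjl hfe => ?_
      have h1 : ((j : ℕ) : ℝ) + 1 ≤ (l : ℕ) := by exact_mod_cast hjl
      have h2 := hf2 j
      have h3 := hf1 l
      rw [hfe] at h2
      nlinarith
    classical
    calc k = (Finset.univ.image f).card := by
          rw [Finset.card_image_of_injective _ hinj, Finset.card_univ, Fintype.card_fin]
      _ ≤ (exceedSet t v).card := by
          refine Finset.card_le_card fun i hi => ?_
          obtain ⟨j, _, rfl⟩ := Finset.mem_image.1 hi
          have : (0 : ℝ) ≤ (j : ℕ) * δ := by positivity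
          exact mem_exceedSet.2 (by linarith [hf1 j])

/-- Lower bound for the probability of having no gap longer than `δ`: the samples above `t` and
below `-t` are conditionally independent, and each is free of gaps with conditional probability at
least `c`. -/
lemma sq_le_gapFree {δ t τ ρ c : ℝ} (ht : 0 ≤ t) (hδ : 0 ≤ δ) (hτ : t + δ ≤ τ) (hρ0 : 0 ≤ ρ)
    (hρ1 : ρ ≤ 1) (hρ : ∀ s, t ≤ s → gaussTail (s + δ) ≤ ρ * gaussTail s) (hc0 : 0 ≤ c)
    (hc : ∀ m, c ≤ ∏ j ∈ Finset.range m, (1 - ρ ^ (j + 1))) :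
    c ^ 2 ≤ (stdGaussianPi ι).real {v | GapFree δ (Set.range v)} +
      (stdGaussianPi ι).real {v | ¬ FullUpTo δ τ v} := by
  have hS : ∀ S : Finset ι, c * gaussTail t ^ S.card ≤
      (stdGaussianPi S).real (upChain S δ t) := by
    intro S
    rw [stdGaussianPi_real_upChain_congr S.equivFin]
    exact (mul_le_mul_of_nonneg_right (hc _) (pow_nonneg (gaussTail_nonneg _) _)).trans
      (le_upChain hδ hρ0 hρ1 hρ S.card t le_rfl)
  have h1 := le_gapFreeAbove_and (ι := ι) (δ := δ) (t := t) (Q := fun _ => True)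
    (fun _ _ _ _ h => h) hS
  have h2 := le_gapFreeAbove_and (ι := ι) (δ := δ) (t := t)
    (dependsOnBelow_neg ht (Q := fun Z _ => GapFree δ (insert t Z))) hS
  have h3 := stdGaussianPi_real_neg (ι := ι) (fun v => GapFreeAbove δ t v)
  have h4 : (stdGaussianPi ι).real {v | GapFreeAbove δ t v ∧ GapFreeAbove δ t (-v)} ≤
      (stdGaussianPi ι).real {v | GapFree δ (Set.range v)} +
      (stdGaussianPi ι).real {v | ¬ FullUpTo δ τ v} := by
    refine (measureReal_mono fun v hv => ?_).trans (measureReal_union_le _ _)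
    by_cases hf : FullUpTo δ τ v
    · exact Or.inl (gapFree_range_of_full ht hδ hτ hf hv.1 hv.2)
    · exact Or.inr hf
  simp only [and_true, Set.ofPred_true, probReal_univ, mul_one] at h1
  refine le_trans ?_ (h2.trans h4)
  rw [sq]
  exact mul_le_mul_of_nonneg_left (h1.trans h3.ge) hc0

/-- Upper bound for the probability of having no gap longer than `δ`: up to rare events, there are
at least `k` points above `t`, which form a chain up to at most `T`, and likewise below `-t`. -/
lemma gapFree_le {δ t τ T ρ : ℝ} {k : ℕ} (ht : 0 ≤ t) (htT : t ≤ T) (hδ : 0 ≤ δ) (hk : 1 ≤ k)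
    (hτ : t + k * δ ≤ τ) (hρ0 : 0 ≤ ρ) (hρ1 : ρ ≤ 1)
    (hρ : ∀ s, t ≤ s → s ≤ T → ρ * gaussTail s ≤ gaussTail (s + δ)) :
    (stdGaussianPi ι).real {v | GapFree δ (Set.range v)} ≤
      (∏ j ∈ Finset.range k, (1 - ρ ^ (j + 1))) ^ 2 +
      (stdGaussianPi ι).real {v | ¬ FullUpTo δ τ v} +
      2 * (stdGaussianPi ι).real {v | ∃ i, T < v i} := by
  have hfac : ∀ j : ℕ, 0 ≤ 1 - ρ ^ (j + 1) := fun j => sub_nonneg.2 (pow_le_one₀ hρ0 hρ1)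
  set c := ∏ j ∈ Finset.range k, (1 - ρ ^ (j + 1)) with hc
  have hc0 : 0 ≤ c := Finset.prod_nonneg fun j _ => hfac j
  have hS : ∀ S : Finset ι, k ≤ S.card →
      (stdGaussianPi S).real (upChainUpTo S δ T t) ≤ c * gaussTail t ^ S.card := by
    intro S hkS
    rw [stdGaussianPi_real_upChainUpTo_congr S.equivFin]
    refine (upChainUpTo_le hδ hρ0 hρ1 hρ S.card t le_rfl htT).trans
      (mul_le_mul_of_nonneg_right ?_ (pow_nonneg (gaussTail_nonneg _) _))
    exact antitone_prod_one_sub_pow hρ0 hρ1 hkS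
  have h1 := chainAbove_and_le (ι := ι) (δ := δ) (t := t) (T := T) (k := k) (Q := fun _ => True)
    (fun _ _ _ _ h => h) hc0 hS
  have h2 := chainAbove_and_le (ι := ι) (δ := δ) (t := t) (T := T) (k := k)
    (dependsOnBelow_neg ht (Q := fun Z S => GapFree δ (insert t Z) ∧ (∀ z ∈ Z, z ≤ T) ∧
      k ≤ S.card)) hc0 hS
  have h3 := stdGaussianPi_real_neg (ι := ι) (fun v => ChainAbove δ T t k v)
  have h5 := stdGaussianPi_real_neg (ι := ι) (fun v => ∃ i, T < v i)
  have h4 : (stdGaussianPi ι).real {v | GapFree δ (Set.range v)} ≤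
      (stdGaussianPi ι).real {v | ChainAbove δ T t k v ∧ ChainAbove δ T t k (-v)} +
      (stdGaussianPi ι).real {v | ¬ FullUpTo δ τ v} +
      ((stdGaussianPi ι).real {v | ∃ i, T < v i} +
        (stdGaussianPi ι).real {v | ∃ i, T < (-v) i}) := by
    refine (measureReal_mono (s₂ := ({v | ChainAbove δ T t k v ∧ ChainAbove δ T t k (-v)} ∪
      {v | ¬ FullUpTo δ τ v}) ∪ ({v | ∃ i, T < v i} ∪ {v | ∃ i, T < (-v) i})) ?_).trans
      ((measureReal_union_le _ _).trans
        (add_le_add (measureReal_union_le _ _) (measureReal_union_le _ _)))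
    intro v hv
    by_cases hf : FullUpTo δ τ v
    swap
    · exact Or.inl (Or.inr hf)
    by_cases hT1 : ∃ i, T < v i
    · exact Or.inr (Or.inl hT1)
    by_cases hT2 : ∃ i, T < (-v) i
    · exact Or.inr (Or.inr hT2)
    push Not at hT1 hT2
    have hv' : GapFree δ (Set.range (-v)) := by
      rw [show Set.range (-v) = -Set.range v by
        ext z
        simp [neg_eq_iff_eq_neg]]
      exact GapFree.neg hv
    refine Or.inl (Or.inl ⟨chainAbove_of_full hδ hk hτ (fun y hy hyτ => hf y ?_) hT1 hv,
      chainAbove_of_full hδ hk hτ (fun y hy hyτ => ?_) hT2 hv'⟩)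
    · exact abs_le.2 ⟨by linarith, by linarith⟩
    · obtain ⟨i, h6, h7⟩ := hf (-y - δ) (abs_le.2 ⟨by linarith, by linarith⟩)
      exact ⟨i, by simp only [Pi.neg_apply]; linarith, by simp only [Pi.neg_apply]; linarith⟩
  rw [h5] at h4
  simp only [and_true, Set.ofPred_true, probReal_univ, mul_one] at h1
  have h6 : (stdGaussianPi ι).real {v | ChainAbove δ T t k v ∧ ChainAbove δ T t k (-v)} ≤
      c ^ 2 := by
    refine h2.trans ?_
    rw [sq]
    exact mul_le_mul_of_nonneg_left (h3.le.trans h1) hc0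
  linarith

lemma stdGaussianPi_real_exists_lt_le (T : ℝ) :
    (stdGaussianPi ι).real {v | ∃ i, T < v i} ≤ Fintype.card ι * gaussTail T := by
  have h1 : {v : ι → ℝ | ∃ i, T < v i} = ⋃ i, Function.eval i ⁻¹' Set.Ioi T := by
    ext v
    simp
  rw [h1]
  refine (measureReal_iUnion_fintype_le _).trans (le_of_eq ?_)
  have h2 : ∀ i, (stdGaussianPi ι).real (Function.eval i ⁻¹' Set.Ioi T) = gaussTail T := fun i =>
    (measurePreserving_eval (fun _ : ι => gaussianReal 0 1) i).measureReal_preimage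
      measurableSet_Ioi.nullMeasurableSet
  simp [h2]

lemma stdGaussianPi_real_forall_notMem_Ioc_le {a b M : ℝ} (hab : a ≤ b) (ha : -M ≤ a)
    (hb : b ≤ M) :
    (stdGaussianPi ι).real {v | ∀ i, v i ∉ Set.Ioc a b} ≤
      Real.exp (-(Fintype.card ι * ((b - a) * gaussianPDFReal 0 1 M))) := by
  have h1 : {v : ι → ℝ | ∀ i, v i ∉ Set.Ioc a b} = Set.univ.pi fun _ => (Set.Ioc a b)ᶜ := by
    ext v
    simp
  rw [h1, measureReal_def, Measure.pi_pi, ENNReal.toReal_prod]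
  simp only [← measureReal_def, Finset.prod_const, Finset.card_univ]
  rw [probReal_compl_eq_one_sub measurableSet_Ioc, gaussianReal_real_Ioc hab, ← mul_neg,
    Real.exp_nat_mul]
  have h2 := le_gaussTail_sub hab ha hb
  refine pow_le_pow_left₀ ?_ ?_ _
  · linarith [gaussTail_le_one a, gaussTail_nonneg b]
  · linarith [Real.one_sub_le_exp_neg (gaussTail a - gaussTail b),
      Real.one_sub_le_exp_neg ((b - a) * gaussianPDFReal 0 1 M),
      Real.add_one_le_exp (-((b - a) * gaussianPDFReal 0 1 M))]

/-- Union bound over cells of length `δ / 2` for the event that some interval of length `δ` in the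
bulk contains no sample point. -/
lemma stdGaussianPi_real_not_full_le {δ τ M : ℝ} (hδ : 0 < δ) (hM : τ + 2 * δ ≤ M) (hτ : 0 ≤ τ) :
    (stdGaussianPi ι).real {v | ¬ FullUpTo δ τ v} ≤
      4 * M / δ * Real.exp (-(Fintype.card ι * (δ / 2 * gaussianPDFReal 0 1 M))) := by
  set η := δ / 2 with hη
  have hη0 : 0 < η := by positivity
  set L := ⌊M / η⌋₊ with hL
  have hL1 : L * η ≤ M := by
    rw [← le_div_iff₀ hη0]
    exact Nat.floor_le (div_nonneg (by linarith) hη0.le)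
  have hL2 : M < (L + 1) * η := by
    rw [← div_lt_iff₀ hη0]
    exact Nat.lt_floor_add_one _
  set cell : ℕ → Set (ι → ℝ) := fun i =>
    {v | ∀ l, v l ∉ Set.Ioc (((i : ℝ) - L) * η) (((i : ℝ) - L) * η + η)} with hcell
  have hsub : {v : ι → ℝ | ¬ FullUpTo δ τ v} ⊆ ⋃ i ∈ Finset.range (2 * L), cell i := by
    intro v hv
    by_contra hne
    refine hv fun y hy => ?_
    obtain ⟨hy1, hy2⟩ := abs_le.1 hy
    have hc1 := Int.le_ceil (y / η)
    have hc2 := Int.ceil_lt_add_one (y / η)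
    rw [div_le_iff₀ hη0] at hc1
    rw [← sub_lt_iff_lt_add, lt_div_iff₀ hη0] at hc2
    have hlow : 0 ≤ ⌈y / η⌉ + L := by
      have h3 : (-1 : ℝ) < ((⌈y / η⌉ + L : ℤ) : ℝ) := by
        push_cast
        by_contra! h4
        nlinarith
      have : (-1 : ℤ) < ⌈y / η⌉ + L := by exact_mod_cast h3
      omega
    have hupp : ⌈y / η⌉ + L < 2 * L := by
      have h3 : ((⌈y / η⌉ : ℤ) : ℝ) < ((L : ℤ) : ℝ) := by
        push_cast
        by_contra! h4
        nlinarith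
      have : ⌈y / η⌉ < (L : ℤ) := by exact_mod_cast h3
      omega
    obtain ⟨i, hi⟩ := Int.eq_ofNat_of_zero_le hlow
    have hir : (i : ℝ) - L = ⌈y / η⌉ := by
      have : ((⌈y / η⌉ + L : ℤ) : ℝ) = ((i : ℤ) : ℝ) := by rw [hi]
      push_cast at this
      linarith
    simp only [Set.mem_iUnion, not_exists] at hne
    have h5 := hne i (Finset.mem_range.2 (by omega))
    simp only [hcell, Set.mem_ofPred_eq, not_forall, not_not, hir] at h5
    obtain ⟨l, hl1, hl2⟩ := h5
    exact ⟨l, by linarith, by linarith⟩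
  calc (stdGaussianPi ι).real {v | ¬ FullUpTo δ τ v}
      ≤ ∑ i ∈ Finset.range (2 * L), (stdGaussianPi ι).real (cell i) :=
        (measureReal_mono hsub (measure_ne_top _ _)).trans (measureReal_biUnion_finset_le _ _)
    _ ≤ ∑ i ∈ Finset.range (2 * L),
        Real.exp (-(Fintype.card ι * (η * gaussianPDFReal 0 1 M))) := by
        refine Finset.sum_le_sum fun i hi => ?_
        have hi1 : (i : ℝ) + 1 ≤ 2 * L := by exact_mod_cast Finset.mem_range.1 hi
        have hi0 : (0 : ℝ) ≤ i := i.cast_nonneg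
        have := stdGaussianPi_real_forall_notMem_Ioc_le (ι := ι) (M := M)
          (a := ((i : ℝ) - L) * η) (b := ((i : ℝ) - L) * η + η)
          (by linarith) (by nlinarith) (by nlinarith)
        rwa [add_sub_cancel_left] at this
    _ = (2 * L) * Real.exp (-(Fintype.card ι * (η * gaussianPDFReal 0 1 M))) := by
        simp
    _ ≤ _ := by
        refine mul_le_mul_of_nonneg_right ?_ (Real.exp_pos _).le
        rw [le_div_iff₀ hδ]
        rw [hη] at hL1
        linarith

end Combine

/-! ### Euler's product and the limiting distribution function -/

/-- Euler's product `∏_{j ≥ 1} (1 - ρ ^ j)`. -/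
noncomputable def eulerProd (ρ : ℝ) : ℝ := ∏' j : ℕ, (1 - ρ ^ (j + 1))

lemma multipliable_one_sub_pow_real {ρ : ℝ} (h0 : 0 ≤ ρ) (h1 : ρ < 1) :
    Multipliable fun j : ℕ => 1 - ρ ^ (j + 1) := by
  have h := multipliable_one_add_of_summable (f := fun n : ℕ => -ρ ^ (n + 1)) (by
    simpa [abs_of_nonneg h0] using
      (summable_nat_add_iff 1).mpr (summable_geometric_of_lt_one h0 h1))
  simpa only [sub_eq_add_neg] using h

lemma tendsto_prod_eulerProd {ρ : ℝ} (h0 : 0 ≤ ρ) (h1 : ρ < 1) :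
    Tendsto (fun k => ∏ j ∈ Finset.range k, (1 - ρ ^ (j + 1))) atTop (𝓝 (eulerProd ρ)) :=
  (multipliable_one_sub_pow_real h0 h1).hasProd.tendsto_prod_nat

lemma eulerProd_le_prod {ρ : ℝ} (h0 : 0 ≤ ρ) (h1 : ρ < 1) (k : ℕ) :
    eulerProd ρ ≤ ∏ j ∈ Finset.range k, (1 - ρ ^ (j + 1)) :=
  (antitone_prod_one_sub_pow h0 h1.le).le_of_tendsto (tendsto_prod_eulerProd h0 h1) k

lemma eulerProd_nonneg {ρ : ℝ} (h0 : 0 ≤ ρ) (h1 : ρ < 1) : 0 ≤ eulerProd ρ :=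
  ge_of_tendsto' (tendsto_prod_eulerProd h0 h1) fun _ =>
    Finset.prod_nonneg fun _ _ => sub_nonneg.2 (pow_le_one₀ h0 h1.le)

lemma eulerProd_le_one_sub {ρ : ℝ} (h0 : 0 ≤ ρ) (h1 : ρ < 1) : eulerProd ρ ≤ 1 - ρ := by
  simpa using eulerProd_le_prod h0 h1 1

lemma eulerProd_zero : eulerProd 0 = 1 := by simp [eulerProd]

lemma eulerProd_antitone {ρ σ : ℝ} (h0 : 0 ≤ ρ) (h : ρ ≤ σ) (h1 : σ < 1) :
    eulerProd σ ≤ eulerProd ρ := by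
  refine le_of_tendsto_of_tendsto' (tendsto_prod_eulerProd (h0.trans h) h1)
    (tendsto_prod_eulerProd h0 (h.trans_lt h1)) fun k => ?_
  refine Finset.prod_le_prod
    (fun j _ => sub_nonneg.2 (pow_le_one₀ (h0.trans h) h1.le)) fun j _ => ?_
  gcongr

lemma continuousOn_eulerProd {r : ℝ} (h0 : 0 ≤ r) (h1 : r < 1) :
    ContinuousOn eulerProd (Set.Icc 0 r) := by
  have h := ((summable_nat_add_iff 1).mpr
    (summable_geometric_of_lt_one h0 h1)).hasProdUniformlyOn_nat_one_add
    (f := fun (n : ℕ) (ρ : ℝ) => -ρ ^ (n + 1)) (isCompact_Icc (a := (0 : ℝ)) (b := r))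
    (.of_forall fun n ρ hρ => by
      simpa [abs_of_nonneg hρ.1] using pow_le_pow_left₀ hρ.1 hρ.2 (n + 1)) (fun _ => by fun_prop)
  rw [hasProdUniformlyOn_iff_tendstoUniformlyOn] at h
  have h2 := h.continuousOn (Eventually.of_forall fun s => by fun_prop).frequently
  simp only [← sub_eq_add_neg] at h2
  exact h2

lemma deheuvelsCDF_of_pos {x : ℝ} (hx : 0 < x) :
    deheuvelsCDF x = eulerProd (Real.exp (-x)) ^ 2 := by
  have h1 : Real.exp (-x) < 1 := by simpa using hx
  rw [deheuvelsCDF, if_neg hx.le.not_gt, eulerProd,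
    ← (multipliable_one_sub_pow_real (Real.exp_pos _).le h1).tprod_pow]
  refine tprod_congr fun j => ?_
  rw [← Real.exp_nat_mul]
  push_cast
  ring_nf

lemma deheuvelsCDF_of_nonpos {x : ℝ} (hx : x ≤ 0) : deheuvelsCDF x = 0 := by
  rcases hx.lt_or_eq with hx | rfl
  · rw [deheuvelsCDF, if_pos hx]
  · rw [deheuvelsCDF, if_neg (lt_irrefl _)]
    -- at `x = 0` every factor vanishes
    exact tprod_of_exists_eq_zero ⟨0, by simp⟩

lemma multipliable_deheuvels {x : ℝ} (hx : 0 ≤ x) :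
    Multipliable fun j : ℕ => (1 - Real.exp (-((j : ℝ) + 1) * x)) ^ 2 := by
  rcases hx.eq_or_lt with rfl | hx
  · exact multipliable_of_exists_eq_zero ⟨0, by simp⟩
  · have h1 : Real.exp (-x) < 1 := by simpa using hx
    have h2 := multipliable_one_sub_pow_real (Real.exp_pos (-x)).le h1
    refine (h2.mul h2).congr fun j => ?_
    rw [← Real.exp_nat_mul, ← sq]
    push_cast
    ring_nf

lemma deheuvelsCDF_nonneg (x : ℝ) : 0 ≤ deheuvelsCDF x := by
  rcases le_or_gt x 0 with hx | hx
  · exact (deheuvelsCDF_of_nonpos hx).ge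
  · rw [deheuvelsCDF_of_pos hx]
    positivity

lemma deheuvelsCDF_le {x : ℝ} (hx : 0 < x) : deheuvelsCDF x ≤ 1 - Real.exp (-x) := by
  have h1 : Real.exp (-x) < 1 := by simpa using hx
  have h0 := (Real.exp_pos (-x)).le
  rw [deheuvelsCDF_of_pos hx]
  have h2 := eulerProd_le_one_sub h0 h1
  have h3 := eulerProd_nonneg h0 h1
  nlinarith

lemma monotone_deheuvelsCDF : Monotone deheuvelsCDF := by
  intro x y hxy
  rcases le_or_gt x 0 with hx | hx
  · rw [deheuvelsCDF_of_nonpos hx]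
    exact deheuvelsCDF_nonneg y
  · have hy := hx.trans_le hxy
    rw [deheuvelsCDF_of_pos hx, deheuvelsCDF_of_pos hy]
    have h1 : Real.exp (-x) < 1 := by simpa using hx
    refine pow_le_pow_left₀ (eulerProd_nonneg (Real.exp_pos _).le h1) ?_ 2
    exact eulerProd_antitone (Real.exp_pos _).le (Real.exp_le_exp.2 (by linarith)) h1

lemma continuousAt_eulerProd_exp_neg {x : ℝ} (hx : 0 < x) :
    ContinuousAt (fun y => eulerProd (Real.exp (-y))) x := by
  have h1 : Real.exp (-(x / 2)) < 1 := by simpa using hx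
  have h2 : Set.Icc 0 (Real.exp (-(x / 2))) ∈ 𝓝 (Real.exp (-x)) :=
    Icc_mem_nhds (Real.exp_pos _) (Real.exp_lt_exp.2 (by linarith))
  exact ContinuousAt.comp (f := fun y => Real.exp (-y))
    ((continuousOn_eulerProd (Real.exp_pos _).le h1).continuousAt h2) (by fun_prop)

lemma continuousAt_deheuvelsCDF_of_pos {x : ℝ} (hx : 0 < x) : ContinuousAt deheuvelsCDF x := by
  refine ((continuousAt_eulerProd_exp_neg hx).pow 2).congr ?_
  filter_upwards [lt_mem_nhds hx] with y hy
  exact (deheuvelsCDF_of_pos hy).symm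

lemma tendsto_deheuvelsCDF_atTop : Tendsto deheuvelsCDF atTop (𝓝 1) := by
  have h1 : Tendsto (fun x => Real.exp (-x)) atTop (𝓝[Set.Icc 0 (1 / 2)] 0) := by
    refine tendsto_nhdsWithin_iff.2 ⟨Real.tendsto_exp_neg_atTop_nhds_zero, ?_⟩
    filter_upwards [Real.tendsto_exp_neg_atTop_nhds_zero.eventually
      (ge_mem_nhds (show (0 : ℝ) < 1 / 2 by norm_num))] with x hx
    exact ⟨(Real.exp_pos _).le, hx⟩
  have h2 := ((continuousOn_eulerProd (r := 1 / 2) (by norm_num) (by norm_num)) 0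
    (by norm_num)).tendsto.comp h1
  rw [eulerProd_zero] at h2
  have h3 := h2.pow 2
  rw [one_pow] at h3
  refine h3.congr' ?_
  filter_upwards [eventually_gt_atTop 0] with x hx
  exact (deheuvelsCDF_of_pos hx).symm

lemma continuousWithinAt_Ici_deheuvelsCDF (x : ℝ) :
    ContinuousWithinAt deheuvelsCDF (Set.Ici x) x := by
  rcases lt_trichotomy x 0 with hx | rfl | hx
  · refine ContinuousAt.continuousWithinAt ?_
    refine (continuousAt_const (y := (0 : ℝ))).congr ?_
    filter_upwards [gt_mem_nhds hx] with y hy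
    exact (deheuvelsCDF_of_nonpos hy.le).symm
  · have h0 : deheuvelsCDF 0 = 0 := deheuvelsCDF_of_nonpos le_rfl
    rw [ContinuousWithinAt, h0]
    refine squeeze_zero' (g := fun y => 1 - Real.exp (-y))
      (Eventually.of_forall deheuvelsCDF_nonneg) ?_ ?_
    · filter_upwards [self_mem_nhdsWithin] with y hy
      rcases (Set.mem_Ici.1 hy).eq_or_lt with rfl | hy
      · simp [h0]
      · exact deheuvelsCDF_le hy
    · have : Continuous fun y : ℝ => 1 - Real.exp (-y) := by fun_prop
      simpa using (this.tendsto 0).mono_left nhdsWithin_le_nhds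
  · exact (continuousAt_deheuvelsCDF_of_pos hx).continuousWithinAt

lemma exists_measure_cdf_eq_deheuvelsCDF :
    ∃ D : Measure ℝ, IsProbabilityMeasure D ∧ ∀ x : ℝ, cdf D x = deheuvelsCDF x := by
  set f : StieltjesFunction ℝ :=
    ⟨deheuvelsCDF, monotone_deheuvelsCDF, continuousWithinAt_Ici_deheuvelsCDF⟩ with hf
  have h0 : Tendsto f atBot (𝓝 0) := by
    refine tendsto_const_nhds.congr' ?_
    filter_upwards [eventually_le_atBot 0] with x hx
    exact (deheuvelsCDF_of_nonpos hx).symm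
  have h1 : Tendsto f atTop (𝓝 1) := tendsto_deheuvelsCDF_atTop
  refine ⟨f.measure, ⟨by rw [f.measure_univ h0 h1, sub_zero, ENNReal.ofReal_one]⟩, fun x => ?_⟩
  rw [cdf_measure_stieltjesFunction f h0 h1]

/-! ### Asymptotics -/

/-- With `n = exp (a² / 2)` points, `a = √(2 log n)`, the union bound for an empty interval of
length `x / a` within `[-κa, κa]`, `κ < 1`, tends to `0`: each such interval has mass of larger
order than `1 / n`. -/
lemma tendsto_bulk_bound {x κ : ℝ} (hx : 0 < x) (hκ0 : 0 < κ) (hκ1 : κ < 1) :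
    Tendsto (fun a : ℝ => 4 * (κ * a) / (x / a) *
      Real.exp (-(Real.exp (a ^ 2 / 2) * (x / a / 2 * gaussianPDFReal 0 1 (κ * a)))))
      atTop (𝓝 0) := by
  set b := (√(2 * Real.pi))⁻¹ with hb
  have hb0 : 0 < b := by positivity
  set c := (1 - κ ^ 2) / 2 with hc
  have hc0 : 0 < c := by
    have : κ ^ 2 < 1 := by nlinarith
    linarith
  refine squeeze_zero' (g := fun a => 16 * κ / (x ^ 2 * b * c ^ 2) * a⁻¹) ?_ ?_ ?_
  · filter_upwards [eventually_gt_atTop 0] with a ha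
    positivity
  · filter_upwards [eventually_gt_atTop 0] with a ha
    set w := Real.exp (a ^ 2 / 2) * (x / a / 2 * gaussianPDFReal 0 1 (κ * a)) with hw
    have hw1 : w = x * b / (2 * a) * Real.exp (c * a ^ 2) := by
      rw [hw, gaussianPDFReal_std, ← hb, show c * a ^ 2 = a ^ 2 / 2 + -(κ * a) ^ 2 / 2 by
        rw [hc]; ring, Real.exp_add]
      ring
    have h1 : (c * a ^ 2) ^ 2 / 2 ≤ Real.exp (c * a ^ 2) := by
      have := Real.quadratic_le_exp_of_nonneg (x := c * a ^ 2) (by positivity)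
      have h2 : 0 ≤ c * a ^ 2 := by positivity
      linarith
    have h2 : x * b * c ^ 2 * a ^ 3 / 4 ≤ w := by
      calc x * b * c ^ 2 * a ^ 3 / 4 = x * b / (2 * a) * ((c * a ^ 2) ^ 2 / 2) := by
            field_simp
            ring
        _ ≤ w := by
            rw [hw1]
            gcongr
    have hw0 : 0 < x * b * c ^ 2 * a ^ 3 / 4 := by positivity
    have h3 : Real.exp (-w) ≤ (x * b * c ^ 2 * a ^ 3 / 4)⁻¹ := by
      rw [Real.exp_neg]
      refine inv_anti₀ hw0 (h2.trans ?_)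
      linarith [Real.add_one_le_exp w]
    calc 4 * (κ * a) / (x / a) * Real.exp (-w)
        ≤ 4 * (κ * a) / (x / a) * (x * b * c ^ 2 * a ^ 3 / 4)⁻¹ := by gcongr
      _ = 16 * κ / (x ^ 2 * b * c ^ 2) * a⁻¹ := by
          field_simp
          ring
  · rw [← mul_zero (16 * κ / (x ^ 2 * b * c ^ 2))]
    exact tendsto_inv_atTop_zero.const_mul _

/-- With `n = exp (a² / 2)` points, `a = √(2 log n)`, the largest one is below `(1 + ε) a` with
probability tending to one. -/
lemma tendsto_exp_mul_gaussTail {ε : ℝ} (hε : 0 < ε) :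
    Tendsto (fun a : ℝ => Real.exp (a ^ 2 / 2) * gaussTail ((1 + ε) * a)) atTop (𝓝 0) := by
  refine squeeze_zero' (g := fun a : ℝ => Real.exp (-(ε * a ^ 2))) ?_ ?_ ?_
  · exact Eventually.of_forall fun a => mul_nonneg (Real.exp_pos _).le (gaussTail_nonneg _)
  · filter_upwards [eventually_ge_atTop 0] with a ha
    have h := gaussTail_le_exp (t := (1 + ε) * a) (by positivity)
    refine (mul_le_mul_of_nonneg_left h (Real.exp_pos _).le).trans ?_
    rw [← Real.exp_add]
    refine Real.exp_le_exp.2 ?_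
    nlinarith [mul_nonneg (sq_nonneg ε) (sq_nonneg a)]
  · exact Real.tendsto_exp_neg_atTop_nhds_zero.comp
      ((tendsto_pow_atTop two_ne_zero).const_mul_atTop hε)

lemma gaussTail_add_le_near {x ε a s : ℝ} (hx : 0 < x) (ha : 0 < a) (hs : (1 - ε) * a ≤ s) :
    gaussTail (s + x / a) ≤ Real.exp (-((1 - ε) * x)) * gaussTail s := by
  refine (gaussTail_add_le (by positivity)).trans
    (mul_le_mul_of_nonneg_right (Real.exp_le_exp.2 ?_) (gaussTail_nonneg _))
  have h1 : (1 - ε) * a * (x / a) ≤ s * (x / a) := by gcongr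
  have h2 : (1 - ε) * a * (x / a) = (1 - ε) * x := by field_simp
  nlinarith [sq_nonneg (x / a)]

lemma eventually_le_gaussTail_add_near {x ε : ℝ} (hx : 0 < x) (hε : 0 < ε) (hε1 : ε < 1) :
    ∀ᶠ a in atTop, ∀ s, (1 - ε) * a ≤ s → s ≤ (1 + ε) * a →
      Real.exp (-((1 + 3 * ε) * x)) * gaussTail s ≤ gaussTail (s + x / a) := by
  have h1 : Tendsto (fun a : ℝ => Real.exp (-(x / a) ^ 2 / 2) *
      (1 - Real.exp (-((1 - ε) * ε * a ^ 2)))) atTop (𝓝 1) := by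
    have h2 : Tendsto (fun a : ℝ => x / a) atTop (𝓝 0) := tendsto_const_nhds.div_atTop tendsto_id
    have h3 : Tendsto (fun a : ℝ => Real.exp (-(x / a) ^ 2 / 2)) atTop (𝓝 1) := by
      have h4 : Continuous fun y : ℝ => Real.exp (-y ^ 2 / 2) := by fun_prop
      simpa [Function.comp_def] using (h4.tendsto 0).comp h2
    have h5 : Tendsto (fun a : ℝ => Real.exp (-((1 - ε) * ε * a ^ 2))) atTop (𝓝 0) :=
      Real.tendsto_exp_neg_atTop_nhds_zero.comp
        ((tendsto_pow_atTop two_ne_zero).const_mul_atTop (mul_pos (sub_pos.2 hε1) hε))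
    simpa using h3.mul (h5.const_sub 1)
  have h6 : Real.exp (-(ε * x)) < 1 := by
    rw [Real.exp_lt_one_iff]
    have := mul_pos hε hx
    linarith
  filter_upwards [h1.eventually (lt_mem_nhds h6), eventually_gt_atTop 0] with a ha ha0 s hs1 hs2
  have hT : s ≤ (1 + 2 * ε) * a := by nlinarith
  have h7 := le_gaussTail_add (t := s) (T := (1 + 2 * ε) * a) (δ := x / a) (by positivity) hT
  have h8 : gaussTail ((1 + 2 * ε) * a) ≤ Real.exp (-((1 - ε) * ε * a ^ 2)) * gaussTail s := by
    have h9 := gaussTail_add_le (t := s) (δ := (1 + 2 * ε) * a - s) (by linarith)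
    rw [add_sub_cancel] at h9
    refine h9.trans (mul_le_mul_of_nonneg_right (Real.exp_le_exp.2 ?_) (gaussTail_nonneg _))
    have h10 : (1 - ε) * a * (ε * a) ≤ s * ((1 + 2 * ε) * a - s) :=
      mul_le_mul hs1 (by linarith) (by positivity)
        (le_trans (mul_nonneg (sub_nonneg.2 hε1.le) ha0.le) hs1)
    nlinarith [sq_nonneg ((1 + 2 * ε) * a - s)]
  have h11 : (1 + 2 * ε) * a * (x / a) = (1 + 2 * ε) * x := by field_simp
  rw [h11] at h7
  refine le_trans ?_ h7
  calc Real.exp (-((1 + 3 * ε) * x)) * gaussTail s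
      = Real.exp (-((1 + 2 * ε) * x)) * (Real.exp (-(ε * x)) * gaussTail s) := by
        rw [← mul_assoc, ← Real.exp_add]
        ring_nf
    _ ≤ Real.exp (-((1 + 2 * ε) * x)) * ((Real.exp (-(x / a) ^ 2 / 2) *
          (1 - Real.exp (-((1 - ε) * ε * a ^ 2)))) * gaussTail s) :=
        mul_le_mul_of_nonneg_left (mul_le_mul_of_nonneg_right ha.le (gaussTail_nonneg _))
          (Real.exp_pos _).le
    _ = Real.exp (-((1 + 2 * ε) * x) - (x / a) ^ 2 / 2) *
          (gaussTail s - Real.exp (-((1 - ε) * ε * a ^ 2)) * gaussTail s) := by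
        rw [sub_eq_add_neg (-((1 + 2 * ε) * x)), Real.exp_add, ← neg_div]
        ring
    _ ≤ _ := mul_le_mul_of_nonneg_left (by linarith) (Real.exp_pos _).le

/-- The normalizing sequence `a_n = √(2 log n)`. -/
noncomputable def gaussScale (n : ℕ) : ℝ := √(2 * Real.log n)

lemma tendsto_gaussScale : Tendsto gaussScale atTop atTop :=
  Real.tendsto_sqrt_atTop.comp
    ((Real.tendsto_log_atTop.comp tendsto_natCast_atTop_atTop).const_mul_atTop two_pos)

lemma exp_gaussScale_sq {n : ℕ} (hn : 1 ≤ n) : Real.exp (gaussScale n ^ 2 / 2) = n := by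
  have h1 : (1 : ℝ) ≤ n := by exact_mod_cast hn
  rw [gaussScale, Real.sq_sqrt (by have := Real.log_nonneg h1; positivity),
    mul_div_cancel_left₀ _ two_ne_zero, Real.exp_log (by linarith)]

lemma tendsto_not_full {x ε : ℝ} (hx : 0 < x) (hε : 0 < ε) (hε1 : ε < 1) :
    Tendsto (fun n : ℕ => (stdGaussianPi (Fin n)).real
      {v | ¬ FullUpTo (x / gaussScale n) ((1 - ε) * gaussScale n) v}) atTop (𝓝 0) := by
  have h1 := (tendsto_bulk_bound (κ := 1 - ε / 2) hx (by linarith) (by linarith)).comp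
    tendsto_gaussScale
  refine squeeze_zero' (Eventually.of_forall fun n => measureReal_nonneg) ?_ h1
  have h2 : Tendsto (fun n : ℕ => ε / 2 * gaussScale n ^ 2) atTop atTop :=
    ((tendsto_pow_atTop two_ne_zero).comp tendsto_gaussScale).const_mul_atTop (by positivity)
  filter_upwards [tendsto_gaussScale.eventually (eventually_gt_atTop 0), eventually_ge_atTop 1,
    h2.eventually (eventually_ge_atTop (2 * x))] with n ha hn h3
  have h4 : 2 * (x / gaussScale n) ≤ ε / 2 * gaussScale n := by
    rw [← mul_div_assoc, div_le_iff₀ ha]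
    linarith
  have h5 := stdGaussianPi_real_not_full_le (ι := Fin n) (δ := x / gaussScale n)
    (τ := (1 - ε) * gaussScale n) (M := (1 - ε / 2) * gaussScale n) (by positivity)
    (by linarith) (mul_nonneg (by linarith) ha.le)
  simpa only [Function.comp_apply, exp_gaussScale_sq hn, Fintype.card_fin] using h5

lemma tendsto_exists_gt {ε : ℝ} (hε : 0 < ε) :
    Tendsto (fun n : ℕ => (stdGaussianPi (Fin n)).real
      {v | ∃ i, (1 + ε) * gaussScale n < v i}) atTop (𝓝 0) := by
  refine squeeze_zero' (Eventually.of_forall fun n => measureReal_nonneg) ?_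
    ((tendsto_exp_mul_gaussTail hε).comp tendsto_gaussScale)
  filter_upwards [eventually_ge_atTop 1] with n hn
  simpa only [Function.comp_apply, exp_gaussScale_sq hn, Fintype.card_fin] using
    stdGaussianPi_real_exists_lt_le (ι := Fin n) ((1 + ε) * gaussScale n)

/-- There is room for `k` disjoint intervals of length `x / a_n` between the threshold
`(1 - ε) a_n` and the end `(1 - ε / 2) a_n` of the region controlled by `tendsto_not_full`. -/
lemma eventually_add_mul_le {x ε : ℝ} (hε : 0 < ε) (k : ℕ) :
    ∀ᶠ n : ℕ in atTop, (1 - ε) * gaussScale n + k * (x / gaussScale n) ≤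
      (1 - ε / 2) * gaussScale n := by
  have h2 : Tendsto (fun n : ℕ => ε / 2 * gaussScale n ^ 2) atTop atTop :=
    ((tendsto_pow_atTop two_ne_zero).comp tendsto_gaussScale).const_mul_atTop (by positivity)
  filter_upwards [tendsto_gaussScale.eventually (eventually_gt_atTop 0),
    h2.eventually (eventually_ge_atTop (k * x))] with n ha h3
  have h4 : k * (x / gaussScale n) ≤ ε / 2 * gaussScale n := by
    rw [← mul_div_assoc, div_le_iff₀ ha]
    linarith
  linarith

/-- The limit theorem for `x > 0`, in terms of gaps. The lower bound uses the full Euler product at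
`(1 - ε) x`; the upper bound uses its first `k` factors at `(1 + 3ε) x`. -/
theorem tendsto_gapFree {x : ℝ} (hx : 0 < x) :
    Tendsto (fun n : ℕ => (stdGaussianPi (Fin n)).real
      {v | GapFree (x / gaussScale n) (Set.range v)}) atTop (𝓝 (deheuvelsCDF x)) := by
  rw [deheuvelsCDF_of_pos hx]
  have hx1 : Real.exp (-x) < 1 := by simpa using hx
  have hsmall : ∀ᶠ ε : ℝ in 𝓝[>] 0, 0 < ε ∧ ε < 1 :=
    (eventually_mem_nhdsWithin).and
      (eventually_nhdsWithin_of_eventually_nhds (gt_mem_nhds one_pos))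
  have hpos := tendsto_gaussScale.eventually (eventually_gt_atTop 0)
  refine tendsto_order.2 ⟨fun l hl => ?_, fun u hu => ?_⟩
  · have hcont : Tendsto (fun ε : ℝ => eulerProd (Real.exp (-((1 - ε) * x))) ^ 2) (𝓝[>] 0)
        (𝓝 (eulerProd (Real.exp (-x)) ^ 2)) := by
      have h1 : ContinuousAt (fun ε : ℝ => eulerProd (Real.exp (-((1 - ε) * x)))) 0 := by
        refine ContinuousAt.comp (f := fun ε : ℝ => (1 - ε) * x)
          (g := fun y => eulerProd (Real.exp (-y))) ?_ (by fun_prop)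
        simpa using continuousAt_eulerProd_exp_neg hx
      simpa [Pi.pow_def] using (h1.pow 2).tendsto.mono_left nhdsWithin_le_nhds
    obtain ⟨ε, hεl, hε0, hε1⟩ := ((hcont.eventually (lt_mem_nhds hl)).and hsmall).exists
    have hy : 0 < (1 - ε) * x := mul_pos (by linarith) hx
    have hρ1 : Real.exp (-((1 - ε) * x)) < 1 := by simpa using hy
    have hlim := (tendsto_not_full hx (half_pos hε0) (by linarith)).const_sub
      (eulerProd (Real.exp (-((1 - ε) * x))) ^ 2)
    rw [sub_zero] at hlim
    filter_upwards [hlim.eventually (lt_mem_nhds hεl), hpos,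
      eventually_add_mul_le (x := x) hε0 1] with n h1 ha h2
    rw [Nat.cast_one, one_mul] at h2
    have h3 := sq_le_gapFree (ι := Fin n) (δ := x / gaussScale n)
      (mul_nonneg (sub_nonneg.2 hε1.le) ha.le) (by positivity) h2 (Real.exp_pos _).le hρ1.le
      (fun s hs => gaussTail_add_le_near hx ha hs) (eulerProd_nonneg (Real.exp_pos _).le hρ1)
      (eulerProd_le_prod (Real.exp_pos _).le hρ1)
    linarith
  · obtain ⟨k, hku, hk⟩ := ((((tendsto_prod_eulerProd (Real.exp_pos _).le hx1).pow 2).eventually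
      (gt_mem_nhds hu)).and (eventually_ge_atTop 1)).exists
    have hcont : Tendsto (fun ε : ℝ =>
        (∏ j ∈ Finset.range k, (1 - Real.exp (-((1 + 3 * ε) * x)) ^ (j + 1))) ^ 2) (𝓝[>] 0)
        (𝓝 ((∏ j ∈ Finset.range k, (1 - Real.exp (-x) ^ (j + 1))) ^ 2)) := by
      have h1 : Continuous fun ε : ℝ =>
          (∏ j ∈ Finset.range k, (1 - Real.exp (-((1 + 3 * ε) * x)) ^ (j + 1))) ^ 2 := by
        fun_prop
      simpa using (h1.tendsto 0).mono_left nhdsWithin_le_nhds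
    obtain ⟨ε, hεu, hε0, hε1⟩ := ((hcont.eventually (gt_mem_nhds hku)).and hsmall).exists
    have hρ1 : Real.exp (-((1 + 3 * ε) * x)) ≤ 1 := by
      rw [Real.exp_le_one_iff]
      have : 0 < (1 + 3 * ε) * x := by positivity
      linarith
    have hlim := ((tendsto_not_full hx (half_pos hε0) (by linarith)).const_add
      ((∏ j ∈ Finset.range k, (1 - Real.exp (-((1 + 3 * ε) * x)) ^ (j + 1))) ^ 2)).add
      ((tendsto_exists_gt hε0).const_mul 2)
    rw [add_zero, mul_zero, add_zero] at hlim
    filter_upwards [hlim.eventually (gt_mem_nhds hεu), hpos,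
      eventually_add_mul_le (x := x) hε0 k,
      tendsto_gaussScale.eventually (eventually_le_gaussTail_add_near hx hε0 hε1)]
      with n h1 ha h2 h3
    exact (gapFree_le (ι := Fin n) (δ := x / gaussScale n) (T := (1 + ε) * gaussScale n)
      (mul_nonneg (sub_nonneg.2 hε1.le) ha.le) (by nlinarith) (by positivity) hk h2
      (Real.exp_pos _).le hρ1 h3).trans_lt h1

theorem theorem1 {Ω : ℕ → Type*} [∀ n, MeasurableSpace (Ω n)]
    (μ : (n : ℕ) → Measure (Ω n)) [∀ n, IsProbabilityMeasure (μ n)]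
    (X : (n : ℕ) → Fin n → Ω n → ℝ)
    (hlaw : ∀ n i, HasLaw (X n i) (gaussianReal 0 1) (μ n))
    (hindep : ∀ n, iIndepFun (X n) (μ n)) :
    (∀ x : ℝ, 0 ≤ x →
      Multipliable (fun j : ℕ => (1 - Real.exp (-((j : ℝ) + 1) * x)) ^ 2)) ∧
    (∃ D : Measure ℝ, IsProbabilityMeasure D ∧ ∀ x : ℝ, cdf D x = deheuvelsCDF x) ∧
    ∀ x : ℝ,
      Tendsto
        (fun n : ℕ => (μ n).real
          {ω | Real.sqrt (2 * Real.log n) * maxSpacing (fun i => X n i ω) ≤ x})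
        atTop (𝓝 (deheuvelsCDF x)) := by
  refine ⟨fun x hx => multipliable_deheuvels hx, exists_measure_cdf_eq_deheuvelsCDF, ?_⟩
  have hgt : ∀ x : ℝ, 0 < x → Tendsto (fun n : ℕ => (μ n).real
      {ω | Real.sqrt (2 * Real.log n) * maxSpacing (fun i => X n i ω) ≤ x})
      atTop (𝓝 (deheuvelsCDF x)) := by
    intro x hx
    refine (tendsto_gapFree hx).congr' ?_
    filter_upwards [tendsto_gaussScale.eventually (eventually_gt_atTop 0)] with n ha
    have hvec := (hindep n).hasLaw_pi (hlaw n)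
    have h1 : {ω | Real.sqrt (2 * Real.log n) * maxSpacing (fun i => X n i ω) ≤ x} =
        (fun ω i => X n i ω) ⁻¹' {v | GapFree (x / gaussScale n) (Set.range v)} := by
      ext ω
      rw [Set.mem_preimage, Set.mem_ofPred_eq, Set.mem_ofPred_eq,
        ← maxSpacing_le_iff _ (by positivity), le_div_iff₀' ha, gaussScale]
    rw [h1, measureReal_def, measureReal_def, stdGaussianPi, ← hvec.map_eq,
      Measure.map_apply_of_aemeasurable hvec.aemeasurable
        (measurableSet_gapFree_range _ fun i => measurable_pi_apply i)]
  intro x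
  rcases lt_trichotomy x 0 with hx | rfl | hx
  · rw [deheuvelsCDF_of_nonpos hx.le]
    refine tendsto_const_nhds.congr fun n => ?_
    have h1 : {ω | Real.sqrt (2 * Real.log n) * maxSpacing (fun i => X n i ω) ≤ x} = ∅ := by
      refine Set.eq_empty_of_forall_notMem fun ω hω => ?_
      exact (hω.trans_lt hx).not_ge (mul_nonneg (Real.sqrt_nonneg _) (maxSpacing_nonneg _))
    rw [h1, measureReal_empty]
  · -- squeeze between `0` and the probabilities at small `y > 0`, using right continuity
    rw [deheuvelsCDF_of_nonpos le_rfl]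
    refine tendsto_order.2 ⟨fun l hl => Eventually.of_forall fun n =>
      hl.trans_le measureReal_nonneg, fun u hu => ?_⟩
    have h0 := (continuousWithinAt_Ici_deheuvelsCDF 0).tendsto.mono_left
      (nhdsWithin_mono 0 Set.Ioi_subset_Ici_self)
    rw [deheuvelsCDF_of_nonpos le_rfl] at h0
    obtain ⟨y, hyu, hy⟩ := ((h0.eventually (gt_mem_nhds hu)).and self_mem_nhdsWithin).exists
    filter_upwards [(hgt y hy).eventually (gt_mem_nhds hyu)] with n hn
    refine (measureReal_mono fun ω hω => ?_).trans_lt hn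
    exact le_trans hω (le_of_lt hy)
  · exact hgt x hx
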